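/- **Setting.** There are $M$ cellular users (CUs) $m$ and $N\ge 1$ D2D pairs $n$. Let $p_c,p_d,n_0>0$. In each period the nonnegative channel gains $h_{mb}$ (CU $m$ to base station), $h^m_{nb}$ (transmitter of pair $n$ to base station on channel $m$), $h^m_{nn}$ (inside pair $n$ on channel $m$) are drawn from a fixed joint law, for which the logarithmic rates below are integrable and, for each $n$, the law of $h^m_{nn}$ does not depend on $m$. Put $R^C_m=\mathbb E\ln(1+p_ch_{mb}/n_0)$, $r^C_{mn}=\frac12[\ln(1+p_ch_{mb}/n_0)+\ln(1+p_dh^m_{nb}/n_0)]$, $R^C_{mn}=\mathbb E\,r^C_{mn}>0$, $R^D_{mn}=\mathbb E\ln(1+p_dh^m_{nn}/n_0)$. Let $0\le\alpha_L\le\alpha_U\le1$, $x_m(R)=\frac{R-R^C_m}{2R}$ (with value $0$ at $R=0$) and $\alpha_m(R)=\max(\alpha_L,\min(x_m(R),\alpha_U))$. The Nash bargaining allocation is $\alpha^*_{mn}=\alpha_m(R^C_{mn})$; whenever $U^C_{mn}(\alpha)=(1-\alpha)R^C_{mn}-R^C_m$ and $U^D_{mn}(\alpha)=\alpha R^D_{mn}$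 can both be made positive on $[\alpha_L,\alpha_U]$, it is the unique maximizer of $U^C_{mn}U^D_{mn}$ subject to both being positive. Write $U^C_{mn},U^D_{mn}$ for the values at $\alpha^*_{mn}$. Let $\theta,\theta'>0$, where $\theta<U^C_{mn}$ whenever $U^C_{mn}>0$, and $\alpha_e=\alpha_U+\theta'$. **Matchings.** An action profile $\mathbf b$ assigns to each CU a D2D pair or $b_0$ (no proposal). Given proposals (a profile together with an offered number for each CU), pair $n$ selects among the CUs proposing to it the one with the largest offer; equal offers are ranked by a fixed strict priority order of $n$. $\mu_{\mathbf b}$ is the matching that results from the offers $\alpha^*_{mb_m}$. A matching is stable if $U^C_{mn}>0$ for every matched $(m,n)$ and there is no $(m,n)$, not matched with each other, such that $m$ and $n$ both strictly prefer each other (by $U^C_{m\cdot}$, resp. $U^D_{\cdot n}$) to what they have, being unmatched having value $0$. **No ties.** Assume: (i) if $n\ne n'$ and $U^C_{mn},U^C_{mn'}>0$, then $U^C_{mn}\neq U^C_{mn'}$; (ii) if $m\ne m'$, $U^C_{mn},U^C_{m'n}>0$ and $\alpha^*_{mn}=\alpha^*_{m'n}$, then $x_m(R^C_{mn})$ and $x_{m'}(R^C_{m'n})$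 are both $>\alpha_U$ or both $<\alpha_L$. **Algorithm EBRI-Q.** Parameters: memory length $L\ge1$, $\varepsilon_0\in(0,1]$, $\zeta,\xi\in(0,1)$, $\varepsilon(t)=\varepsilon_0t^{-1/(ML)}$. The proposals of period 1, the estimates $\hat R_{mn}(1)$, CU $m$'s beliefs $\hat\alpha^{1}_{m'n}$ about the offers of CUs $m'\neq m$, and the utility estimates used in period 2 for actions other than $b_0$ are arbitrary; $\alpha^t_{mn}=\alpha_m(\hat R_{mn}(t))$. In each period $t\ge2$, given the past, the CUs act independently of each other: - With probability $\varepsilon(t)$, CU $m$ selects a uniformly random D2D pair $b^t_m$ and offers $\alpha^{t-1}_{mb^t_m}$ with probability $\zeta$, and $\alpha_e$ with probability $1-\zeta$. - With probability $1-\varepsilon(t)$, it offers $\alpha^{t-1}_{mb^t_m}$ for a selection $b^t_m$ found as follows: with probability $\xi$, $b^t_m=b^{t-1}_m$; with probability $1-\xi$, $b^t_m$ is drawn from a fixed fully supported distribution on the set of actions that have strictly larger average estimated utility $\hat\pi_m$ than $b^{t-1}_m$ against the selections of the others in the last $\min(L,t-1)$ periods (the distribution depending on $m$ and this set only), and $b^t_m=b^{t-1}_m$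 if this set is empty. The D2D pairs then select. The gains of period $t$ are independent of the past and of the decisions of period $t$. If $m$ is selected by $n$, then $\hat R_{mn}(t)=\hat R_{mn}(t-1)+\frac{1}{1+k}(r^C_{mn}(t)-\hat R_{mn}(t-1))$, where $k$ is the number of periods $\tau\le t$ in which $n$ selected $m$; otherwise $\hat R_{mn}(t)=\hat R_{mn}(t-1)$. The belief $\hat\alpha^t_{m'n}$ is the offer of $m'$ in period $t$ if $b^t_{m'}=n$ and that offer is not $\alpha_e$; otherwise $\hat\alpha^t_{m'n}=\hat\alpha^{t-1}_{m'n}$. Finally $\hat\pi_m(\mathbf b)=0$ if $b_m=b_0$; if $b_m=n$, then $\hat\pi_m(\mathbf b)=(1-\alpha^t_{mn})\hat R_{mn}(t)-R^C_m-\theta$ when $n$ would select $m$ under the offers $\alpha^t_{mn}$ of $m$ and $\hat\alpha^t_{m'b_{m'}}$ of $m'\neq m$, and $\hat\pi_m(\mathbf b)=-\theta$ otherwise. **Theorem.** Almost surely $\alpha^t_{mn}\to\alpha^*_{mn}$ for all $m,n$, and $\lim_{t\to\infty}\Pr\{\mu_{\mathbf b^t}\text{ is stable}\}=1$, where $\mathbf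 b^t=(b^t_1,\dots,b^t_M)$. -/

import Mathlib

open MeasureTheory ProbabilityTheory Filter Topology

noncomputable section

namespace EBRIQ

/-- One realisation of all channel gains: `g.1 m` is the gain from CU `m` to the base station,
`g.2.1 m n` the gain from the transmitter of D2D pair `n` to the base station on channel `m`, and
`g.2.2 m n` the gain inside D2D pair `n` on channel `m`. -/
abbrev Gains (M N : ℕ) : Type :=
  (Fin M → ℝ) × (Fin M → Fin N → ℝ) × (Fin M → Fin N → ℝ)

/-- A decision profile: each CU proposes to a D2D pair, or to nobody (`none`, the action `b₀`). -/
abbrev Profile (M N : ℕ) : Type := Fin M → Option (Fin N)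

/-- The data of the network. -/
structure Network (M N : ℕ) where
  /-- transmission power of the CUs -/
  pc : ℝ
  /-- transmission power of the D2D transmitters -/
  pd : ℝ
  /-- noise power -/
  n0 : ℝ
  /-- lower end of the interval of time allocations -/
  αL : ℝ
  /-- upper end of the interval of time allocations -/
  αU : ℝ
  /-- negotiation cost -/
  θ : ℝ
  /-- excess of the exploratory offer over `αU` -/
  θ' : ℝ
  /-- joint law of the channel gains in a period -/
  law : Measure (Gains M N)
  /-- predefined tie-breaking rule of D2D pair `n`: equal offers are ranked by `prio n` -/
  prio : Fin N → (Fin M ↪ ℕ)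

namespace Network

variable {M N : ℕ} (G : Network M N)

/-- Rate of CU `m` on the direct link under the gains `g`. -/
def directRate (g : Gains M N) (m : Fin M) : ℝ := Real.log (1 + G.pc * g.1 m / G.n0)

/-- The sample `r^C_{mn}`: rate of CU `m` in the first two phases when relayed by pair `n`. -/
def relayRate (g : Gains M N) (m : Fin M) (n : Fin N) : ℝ :=
  (1 / 2) * (Real.log (1 + G.pc * g.1 m / G.n0) + Real.log (1 + G.pd * g.2.1 m n / G.n0))

/-- Rate inside D2D pair `n` on channel `m`. -/
def d2dRate (g : Gains M N) (m : Fin M) (n : Fin N) : ℝ :=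
  Real.log (1 + G.pd * g.2.2 m n / G.n0)

/-- `R^C_m`, the expected rate of CU `m` on the direct link. -/
def RC₀ (m : Fin M) : ℝ := ∫ g, G.directRate g m ∂G.law

/-- `R^C_{mn}`, the expected relay rate. -/
def RC (m : Fin M) (n : Fin N) : ℝ := ∫ g, G.relayRate g m n ∂G.law

/-- `R^D_{mn}`, the expected rate inside D2D pair `n` on channel `m`. -/
def RD (m : Fin M) (n : Fin N) : ℝ := ∫ g, G.d2dRate g m n ∂G.law

/-- Utility of CU `m` when it cooperates with pair `n` under time allocation `α`. -/
def UC (m : Fin M) (n : Fin N) (α : ℝ) : ℝ := (1 - α) * G.RC m n - G.RC₀ m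

/-- Utility of D2D pair `n` when it cooperates with CU `m` under time allocation `α`. -/
def UD (m : Fin M) (n : Fin N) (α : ℝ) : ℝ := α * G.RD m n

/-- The allocation `(R - R^C_m) / (2R)` before projection onto `[αL, αU]`. -/
def rawAlloc (m : Fin M) (R : ℝ) : ℝ := (R - G.RC₀ m) / (2 * R)

/-- The time allocation `α*_{mn}(R)` as a function of the (true or estimated) relay rate `R`. -/
def alloc (m : Fin M) (R : ℝ) : ℝ := max G.αL (min (G.rawAlloc m R) G.αU)

/-- The Nash bargaining time allocation `α*_{mn}`. -/
def alphaStar (m : Fin M) (n : Fin N) : ℝ := G.alloc m (G.RC m n)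

/-- The exploratory offer `α_e`. -/
def αe : ℝ := G.αU + G.θ'

/-- Utility of CU `m` with pair `n` at the bargaining outcome. -/
def UCstar (m : Fin M) (n : Fin N) : ℝ := G.UC m n (G.alphaStar m n)

/-- Utility of pair `n` with CU `m` at the bargaining outcome. -/
def UDstar (m : Fin M) (n : Fin N) : ℝ := G.UD m n (G.alphaStar m n)

/-- The standing assumptions of the model. -/
structure Standing : Prop where
  pc_pos : 0 < G.pc
  pd_pos : 0 < G.pd
  n0_pos : 0 < G.n0
  αL_nonneg : 0 ≤ G.αL
  αL_le_αU : G.αL ≤ G.αU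
  αU_le_one : G.αU ≤ 1
  law_prob : IsProbabilityMeasure G.law
  gains_nonneg : ∀ᵐ g ∂G.law,
    (∀ m, 0 ≤ g.1 m) ∧ (∀ m n, 0 ≤ g.2.1 m n) ∧ (∀ m n, 0 ≤ g.2.2 m n)
  /-- for each D2D link the gains on the different channels have the same law -/
  d2d_ident : ∀ n m m', G.law.map (fun g => g.2.2 m n) = G.law.map (fun g => g.2.2 m' n)
  direct_integrable : ∀ m, Integrable (fun g => G.directRate g m) G.law
  relay_integrable : ∀ m n, Integrable (fun g => G.relayRate g m n) G.law
  d2d_integrable : ∀ m n, Integrable (fun g => G.d2dRate g m n) G.law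
  RC_pos : ∀ m n, 0 < G.RC m n
  θ_pos : 0 < G.θ
  θ_small : ∀ m n, 0 < G.UCstar m n → G.θ < G.UCstar m n
  θ'_pos : 0 < G.θ'

/-- No ties in the preferences between mutually acceptable partners: a CU is never indifferent
between two acceptable D2D pairs, and two CUs that both accept a D2D pair are tied for it only
if both allocations are cut off at the same end of `[αL, αU]`. -/
structure NoTies : Prop where
  cu : ∀ m n n', n ≠ n' → 0 < G.UCstar m n → 0 < G.UCstar m n' →
    G.UCstar m n ≠ G.UCstar m n'
  d2d : ∀ n m m', m ≠ m' → 0 < G.UCstar m n → 0 < G.UCstar m' n →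
    G.alphaStar m n = G.alphaStar m' n →
      (G.αU < G.rawAlloc m (G.RC m n) ∧ G.αU < G.rawAlloc m' (G.RC m' n)) ∨
      (G.rawAlloc m (G.RC m n) < G.αL ∧ G.rawAlloc m' (G.RC m' n) < G.αL)

/-- The feasible allocations of the bargaining problem of `(m, n)` (disagreement point `0`). -/
def bargainingSet (m : Fin M) (n : Fin N) : Set ℝ :=
  {α | α ∈ Set.Icc G.αL G.αU ∧ 0 < G.UC m n α ∧ 0 < G.UD m n α}

/-- Solutions of the bargaining problem: feasible maximisers of the Nash product. -/
def IsNashBargaining (m : Fin M) (n : Fin N) (α : ℝ) : Prop :=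
  α ∈ G.bargainingSet m n ∧
    ∀ β ∈ G.bargainingSet m n, G.UC m n β * G.UD m n β ≤ G.UC m n α * G.UD m n α

/-- Whenever the bargaining problem is feasible, `α*_{mn}` is its unique solution. -/
theorem isNashBargaining_iff (hG : G.Standing) (m : Fin M) (n : Fin N)
    (hne : (G.bargainingSet m n).Nonempty) (α : ℝ) :
    G.IsNashBargaining m n α ↔ α = G.alphaStar m n := by
  obtain ⟨a, ⟨ha1, ha2⟩, hC, hD⟩ := hne
  have hR := hG.RC_pos m n
  have hL := hG.αL_nonneg
  have ha0 : 0 ≤ a := hL.trans ha1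
  simp only [UC, UD] at hC hD
  have hDpos : 0 < G.RD m n := pos_of_mul_pos_right hD ha0
  have hapos : 0 < a := pos_of_mul_pos_left hD hDpos.le
  obtain ⟨x, hx⟩ : ∃ x, x = G.rawAlloc m (G.RC m n) := ⟨_, rfl⟩
  have hR0 : G.RC₀ m = G.RC m n - 2 * x * G.RC m n := by
    rw [hx, rawAlloc]; field_simp; ring
  have key : ∀ β, G.UC m n β = G.RC m n * (2 * x - β) := by
    intro β; rw [UC, hR0]; ring
  have hax : a < 2 * x := by
    have h : 0 < G.RC m n * (2 * x - a) := by rw [← key]; exact hC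
    linarith [pos_of_mul_pos_right h hR.le]
  have hs : G.alphaStar m n = max G.αL (min x G.αU) := by rw [hx]; rfl
  obtain ⟨s, hsd⟩ : ∃ s, s = G.alphaStar m n := ⟨_, rfl⟩
  rw [← hsd] at hs ⊢
  have hprod : ∀ β, G.UC m n β * G.UD m n β
      = G.RC m n * G.RD m n * (x ^ 2 - (β - x) ^ 2) := by
    intro β; rw [key, UD]; ring
  have hRD : 0 < G.RC m n * G.RD m n := mul_pos hR hDpos
  have hcases : (s = x ∧ G.αL ≤ x ∧ x ≤ G.αU) ∨ (s = G.αL ∧ x < G.αL) ∨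
      (s = G.αU ∧ G.αU < x) := by
    have hLU := hG.αL_le_αU
    rcases lt_or_ge x G.αL with h | h
    · right; left; exact ⟨by rw [hs, min_eq_left (by linarith), max_eq_left h.le], h⟩
    · rcases lt_or_ge G.αU x with h' | h'
      · right; right; exact ⟨by rw [hs, min_eq_right h'.le, max_eq_right hLU], h'⟩
      · left; exact ⟨by rw [hs, min_eq_left h', max_eq_right h], h, h'⟩
  have hLU := hG.αL_le_αU
  have hsmem : s ∈ G.bargainingSet m n := by
    have : G.αL ≤ s ∧ s ≤ G.αU ∧ 0 < s ∧ s < 2 * x := by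
      rcases hcases with ⟨h, h1, h2⟩ | ⟨h, h1⟩ | ⟨h, h1⟩ <;> rw [h] <;>
        refine ⟨?_, ?_, ?_, ?_⟩ <;> linarith
    refine ⟨⟨this.1, this.2.1⟩, ?_, mul_pos this.2.2.1 hDpos⟩
    rw [key]; exact mul_pos hR (by linarith [this.2.2.2])
  have hclose : ∀ β ∈ Set.Icc G.αL G.αU, (s - x) ^ 2 + (β - s) ^ 2 ≤ (β - x) ^ 2 := by
    rintro β ⟨h3, h4⟩
    rcases hcases with ⟨h, h1, h2⟩ | ⟨h, h1⟩ | ⟨h, h1⟩ <;> rw [h] <;> nlinarith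
  constructor
  · rintro ⟨hmem, hmax⟩
    have h1 := hmax s hsmem
    rw [hprod, hprod] at h1
    have h2 := le_of_mul_le_mul_left h1 hRD
    have h3 := hclose α hmem.1
    have h4 : (α - s) ^ 2 = 0 := le_antisymm (by linarith) (sq_nonneg _)
    have := pow_eq_zero_iff (two_ne_zero) |>.mp h4
    linarith
  · rintro rfl
    refine ⟨hsmem, fun β hβ => ?_⟩
    rw [hprod, hprod]
    have := hclose β hβ.1
    exact mul_le_mul_of_nonneg_left (by nlinarith [sq_nonneg (β - α)]) hRD.le

/-! ### Choices of the D2D pairs, matchings and stability -/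

/-- Under the proposals `(b m, a m)`, D2D pair `n` selects CU `m`: it makes the maximal offer
among the CUs proposing to `n`, ties being broken by the predefined rule. -/
def Selects (b : Profile M N) (a : Fin M → ℝ) (n : Fin N) (m : Fin M) : Prop :=
  b m = some n ∧ ∀ m', b m' = some n →
    a m' < a m ∨ (a m' = a m ∧ G.prio n m' ≤ G.prio n m)

theorem Selects.unique {b : Profile M N} {a : Fin M → ℝ} {n : Fin N} {m m' : Fin M}
    (h : G.Selects b a n m) (h' : G.Selects b a n m') : m = m' := by
  rcases h.2 m' h'.1 with h1 | ⟨h1, h2⟩ <;> rcases h'.2 m h.1 with h3 | ⟨h3, h4⟩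
  · exact absurd h1 h3.le.not_gt
  · exact absurd h1 h3.le.not_gt
  · exact absurd h3 h1.le.not_gt
  · exact (G.prio n).injective (le_antisymm h4 h2)

open scoped Classical in
/-- The choice function `Ch_n` of D2D pair `n` under the proposals `(b m, a m)`. -/
def choice (b : Profile M N) (a : Fin M → ℝ) (n : Fin N) : Option (Fin M) :=
  if h : ∃ m, G.Selects b a n m then some h.choose else none

theorem choice_eq_some_iff (b : Profile M N) (a : Fin M → ℝ) (n : Fin N) (m : Fin M) :
    G.choice b a n = some m ↔ G.Selects b a n m := by
  unfold choice
  split_ifs with h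
  · rw [Option.some_inj]
    exact ⟨fun e => e ▸ h.choose_spec, fun hm => h.choose_spec.unique G hm⟩
  · exact ⟨fun e => absurd e (by simp), fun hm => absurd ⟨m, hm⟩ h⟩

/-- The true offers attached to a profile: `α*_{m b_m}`. -/
def trueOffer (b : Profile M N) (m : Fin M) : ℝ :=
  match b m with
  | some n => G.alphaStar m n
  | none => 0

open scoped Classical in
/-- The matching `μ_b` associated with the profile `b`: `m` and `n` are matched iff
`Ch_n(b) = m` under the true offers. Matchings are partial bijections. -/
def matching (b : Profile M N) : Fin M ≃. Fin N where
  toFun m := if ∃ n, b m = some n ∧ G.choice b (G.trueOffer b) n = some m then b m else none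
  invFun n := G.choice b (G.trueOffer b) n
  inv := by
    intro m n
    constructor
    · intro h
      have hb := ((G.choice_eq_some_iff _ _ _ _).1 h).1
      rw [if_pos ⟨n, hb, h⟩, hb]
    · intro h
      split_ifs at h with h'
      obtain ⟨k, hk, hc⟩ := h'
      rw [hk, Option.some_inj] at h
      exact h ▸ hc

/-- Utility of CU `m` from a partner, being unmatched having utility `0`. -/
def cuValue (m : Fin M) : Option (Fin N) → ℝ
  | some n => G.UCstar m n
  | none => 0

/-- Utility of D2D pair `n` from a partner, being unmatched having utility `0`. -/
def d2dValue (n : Fin N) : Option (Fin M) → ℝ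
  | some m => G.UDstar m n
  | none => 0

/-- `(m, n)` blocks `μ`: not matched together, and both strictly prefer each other. -/
def Blocks (μ : Fin M ≃. Fin N) (m : Fin M) (n : Fin N) : Prop :=
  μ m ≠ some n ∧ G.d2dValue n (μ.symm n) < G.d2dValue n (some m) ∧
    G.cuValue m (μ m) < G.cuValue m (some n)

/-- Stable matchings: matched CUs find their partners acceptable, and no pair blocks. -/
def IsStable (μ : Fin M ≃. Fin N) : Prop :=
  (∀ m n, μ m = some n → 0 < G.cuValue m (some n)) ∧ ¬ ∃ m n, G.Blocks μ m n

end Network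

/-! ### The algorithm -/

/-- Parameters and initial values of the algorithm. -/
structure Params (M N : ℕ) where
  /-- scale of the exploration rate -/
  ε₀ : ℝ
  /-- probability that an exploring CU offers its estimated allocation rather than `α_e` -/
  ζ : ℝ
  /-- inertia -/
  ξ : ℝ
  /-- memory length -/
  L : ℕ
  /-- `reply m S` is the law used by CU `m` to pick an element of a set `S` of better replies -/
  reply : Fin M → Finset (Option (Fin N)) → PMF (Option (Fin N))
  /-- the selections of period 1 -/
  b1 : Profile M N
  /-- the offers of period 1 -/
  a1 : Fin M → ℝ
  /-- initial estimates of the relay rates -/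
  Rhat1 : Fin M → Fin N → ℝ
  /-- `αhat1 m m' n`: initial belief of CU `m` about the offer of CU `m'` to pair `n` -/
  αhat1 : Fin M → Fin M → Fin N → ℝ
  /-- initial estimates of the utilities -/
  πhat1 : Fin M → Profile M N → ℝ

namespace Params

variable {M N : ℕ}

/-- The admissible parameters. -/
structure Valid (P : Params M N) : Prop where
  ε₀_pos : 0 < P.ε₀
  ε₀_le : P.ε₀ ≤ 1
  ζ_pos : 0 < P.ζ
  ζ_lt : P.ζ < 1
  ξ_pos : 0 < P.ξ
  ξ_lt : P.ξ < 1
  L_pos : 1 ≤ P.L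
  reply_support : ∀ m S, S.Nonempty → (P.reply m S).support = (S : Set (Option (Fin N)))

/-- The exploration rate `ε(t) = ε₀ t^{-1/(ML)}`. -/
def ε (P : Params M N) (t : ℕ) : ℝ := P.ε₀ * (t : ℝ) ^ (-1 / ((M : ℝ) * (P.L : ℝ)))

end Params

/-- What the CUs have learnt at the end of a period. -/
structure State (M N : ℕ) where
  /-- estimates of the relay rates -/
  Rhat : Fin M → Fin N → ℝ
  /-- numbers of past cooperations -/
  count : Fin M → Fin N → ℕ
  /-- `αhat m m' n`: belief of CU `m` about the offer of CU `m'` to pair `n` -/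
  αhat : Fin M → Fin M → Fin N → ℝ

/-- The random decision of a CU in a period: its selection, and whether it offers `α_e` (`true`)
or the allocation computed from its current estimate (`false`). -/
abbrev Decision (N : ℕ) : Type := Option (Fin N) × Bool

section Algorithm

variable {M N : ℕ} (G : Network M N) (P : Params M N)

/-- The offers made in a period, from the estimates of the previous period. -/
def offer (s : State M N) (d : Fin M → Decision N) (m : Fin M) : ℝ :=
  if (d m).2 then G.αe else
    match (d m).1 with
    | some n => G.alloc m (s.Rhat m n)
    | none => 0

/-- The state at the end of period 1. -/
def initState : State M N where
  Rhat := P.Rhat1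
  count m n := if G.choice P.b1 P.a1 n = some m then 1 else 0
  αhat := P.αhat1

/-- One period: from the state `s`, the decisions `d` and the channel gains `g` of the period. -/
def step (s : State M N) (d : Fin M → Decision N) (g : Gains M N) : State M N :=
  let b : Profile M N := fun m => (d m).1
  let a : Fin M → ℝ := offer G s d
  let I : Fin M → Fin N → ℕ := fun m n => if G.choice b a n = some m then 1 else 0
  { Rhat := fun m n => s.Rhat m n +
      1 / (1 + ((s.count m n + I m n : ℕ) : ℝ)) * (I m n : ℝ) *
        (G.relayRate g m n - s.Rhat m n)
    count := fun m n => s.count m n + I m n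
    αhat := fun m m' n =>
      open scoped Classical in
      if b m' = some n ∧ a m' ≠ G.αe then a m' else s.αhat m m' n }

/-- The state at the end of period `t`, along decisions `d` and gains `g`; the loop of the
algorithm starts at period 2 (the value at `t = 0` is a dummy). -/
def stateAt (d : ℕ → Fin M → Decision N) (g : ℕ → Gains M N) : ℕ → State M N
  | 0 => initState G P
  | 1 => initState G P
  | t + 2 => step G (stateAt d g (t + 1)) (d (t + 2)) (g (t + 2))

/-- The selections `b^t`. -/
def selection (d : ℕ → Fin M → Decision N) (t : ℕ) : Profile M N :=
  if t ≤ 1 then P.b1 else fun m => (d t m).1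

/-- The estimated allocations `α^t_{mn}`. -/
def alphaAt (d : ℕ → Fin M → Decision N) (g : ℕ → Gains M N) (t : ℕ) (m : Fin M) (n : Fin N) :
    ℝ :=
  G.alloc m ((stateAt G P d g t).Rhat m n)

/-- The estimated utility `π̂_m(b)` at the end of period `t`; refusing to cooperate is worth `0`. -/
def πhat (d : ℕ → Fin M → Decision N) (g : ℕ → Gains M N) (t : ℕ) (m : Fin M)
    (b : Profile M N) : ℝ :=
  match b m with
  | none => 0
  | some n =>
    if t ≤ 1 then P.πhat1 m b
    else
      let a : Fin M → ℝ := fun m' =>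
        if m' = m then alphaAt G P d g t m n
        else
          match b m' with
          | some k => (stateAt G P d g t).αhat m m' k
          | none => 0
      if G.choice b a n = some m then
        (1 - alphaAt G P d g t m n) * (stateAt G P d g t).Rhat m n - G.RC₀ m - G.θ
      else -G.θ

/-- Estimated total utility of action `x` of CU `m` against its memory before period `t`, i.e.
against the selections of the others in the last `L` periods (or all periods, if fewer than `L`
have passed), as evaluated at the end of period `t - 1`. -/
def memoryValue (d : ℕ → Fin M → Decision N) (g : ℕ → Gains M N) (t : ℕ) (m : Fin M)
    (x : Option (Fin N)) : ℝ :=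
  ∑ τ ∈ Finset.Ico (max 1 (t - P.L)) t,
    πhat G P d g (t - 1) m (Function.update (selection P d τ) m x)

open scoped Classical in
/-- The actions that are better replies of CU `m` to its memory than `b^{t-1}_m`. -/
def betterReplies (d : ℕ → Fin M → Decision N) (g : ℕ → Gains M N) (t : ℕ) (m : Fin M) :
    Finset (Option (Fin N)) :=
  {x | memoryValue G P d g t m (selection P d (t - 1) m) < memoryValue G P d g t m x}

open scoped Classical in
/-- Probability that the non-inert better-reply move of CU `m` in period `t` is `x`; without
better replies the CU keeps its previous selection. -/
def replyProb (d : ℕ → Fin M → Decision N) (g : ℕ → Gains M N) (t : ℕ) (m : Fin M)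
    (x : Option (Fin N)) : ℝ :=
  if (betterReplies G P d g t m).Nonempty then
    (P.reply m (betterReplies G P d g t m) x).toReal
  else if x = selection P d (t - 1) m then 1 else 0

/-- Probability that an exploring CU takes the decision `y`. -/
def exploreProb (y : Decision N) : ℝ :=
  match y with
  | (some _, true) => (1 / (N : ℝ)) * (1 - P.ζ)
  | (some _, false) => (1 / (N : ℝ)) * P.ζ
  | (none, _) => 0

/-- Probability that a non-exploring CU `m` takes the decision `y` in period `t`. -/
def exploitProb (d : ℕ → Fin M → Decision N) (g : ℕ → Gains M N) (t : ℕ) (m : Fin M)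
    (y : Decision N) : ℝ :=
  match y with
  | (_, true) => 0
  | (x, false) => P.ξ * (if x = selection P d (t - 1) m then 1 else 0) +
      (1 - P.ξ) * replyProb G P d g t m x

/-- Probability, given the past, that CU `m` takes the decision `y` in period `t`. Only the
values of `d` and `g` before period `t` matter. -/
def decisionProb (d : ℕ → Fin M → Decision N) (g : ℕ → Gains M N) (t : ℕ) (m : Fin M)
    (y : Decision N) : ℝ :=
  P.ε t * exploreProb P y + (1 - P.ε t) * exploitProb G P d g t m y

/-- `D t` and `g t` are the decisions and the channel gains in period `t` of a run of the
algorithm: given the past, the CUs take their decisions independently of each other with the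
prescribed probabilities, and the gains of the period have law `G.law` and are independent of the
past and of the decisions. -/
structure IsRun {Ω : Type*} {mΩ : MeasurableSpace Ω} (μ : Measure Ω) (ℱ : Filtration ℕ mΩ)
    (D : ℕ → Ω → Fin M → Decision N) (g : ℕ → Ω → Gains M N) : Prop where
  decision_adapted : ∀ t, 2 ≤ t → Measurable[ℱ t, ⊤] (D t)
  gains_adapted : ∀ t, 2 ≤ t → Measurable[ℱ t] (g t)
  gains_law : ∀ t, 2 ≤ t → μ.map (g t) = G.law
  gains_indep : ∀ t, 2 ≤ t →
    Indep (MeasurableSpace.comap (g t) inferInstance)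
      (ℱ (t - 1) ⊔ MeasurableSpace.comap (D t) ⊤) μ
  decision_law : ∀ t, 2 ≤ t → ∀ y : Fin M → Decision N,
    μ[Set.indicator {ω | D t ω = y} (fun _ => (1 : ℝ)) | ℱ (t - 1)] =ᵐ[μ]
      fun ω => ∏ m, decisionProb G P (fun τ => D τ ω) (fun τ => g τ ω) t m (y m)

end Algorithm

end EBRIQ

end

/-!
Proposals with the pairs as judges form a matching market in which equilibria of better replies are
stable matchings, and from every profile single better replies lead to an equilibrium: first let the
proposing CUs improve, which terminates because each move raises the mover's own position, then let
the idle CUs enter one at a time, displacing at most one proposer each.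

Exploration has probability of order `1 / t` for every joint decision, so by the conditional
Borel–Cantelli lemma every decision recurs almost surely. Hence every CU is selected infinitely
often by every pair, and the strong law of large numbers along the selected periods makes the
estimates consistent. From some period on they rank pairs and offers as the true utilities do, since
the cost `θ` and the offer `αe` are small, respectively large, enough and there are no ties.

From then on, a potential counting the better replies left to an equilibrium, and the periods left
until it fills the memory, decreases in each period with probability bounded below; once zero it
stays so with probability tending to `1`, as exploration dies out. A process with such a drift
is at zero with probability tending to `1`.
-/

noncomputable section

namespace EBRIQ

/-! ### Descent along a relation -/

section Relation

variable {α : Type*} {r : α → α → Prop} {p q : α → Prop}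

theorem exists_reflTransGen_of_descent (f : α → ℕ)
    (hf : ∀ a, p a → ¬ q a → ∃ b, Relation.ReflTransGen r a b ∧ p b ∧ f b < f a)
    (a : α) (ha : p a) : ∃ b, Relation.ReflTransGen r a b ∧ p b ∧ q b := by
  induction hn : f a using Nat.strong_induction_on generalizing a with
  | _ n ih =>
    by_cases hq : q a
    · exact ⟨a, .refl, ha, hq⟩
    · obtain ⟨b, hab, hb, hlt⟩ := hf a ha hq
      obtain ⟨c, hbc, hc⟩ := ih (f b) (hn ▸ hlt) b hb rfl
      exact ⟨c, hab.trans hbc, hc⟩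

/-- From `a`, the relation `r` leads in exactly `n` steps to a point satisfying `q`. It serves to
measure the distance of a point from the set where `q` holds. -/
def ReachesIn (r : α → α → Prop) (q : α → Prop) : ℕ → α → Prop
  | 0, a => q a
  | n + 1, a => ∃ b, r a b ∧ ReachesIn r q n b

theorem exists_reachesIn {a b : α} (hab : Relation.ReflTransGen r a b) (hb : q b) :
    ∃ n, ReachesIn r q n a := by
  induction hab using Relation.ReflTransGen.head_induction_on with
  | refl => exact ⟨0, hb⟩
  | head hac _ ih =>
    obtain ⟨n, hn⟩ := ih
    exact ⟨n + 1, _, hac, hn⟩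

theorem exists_rank_and_next (h : ∀ a, ∃ b, Relation.ReflTransGen r a b ∧ q b) :
    ∃ (rank : α → ℕ) (next : α → α), ∀ a,
      (rank a = 0 ∧ q a ∧ next a = a) ∨ (r a (next a) ∧ rank (next a) < rank a) := by
  classical
  have hreach : ∀ a, ∃ n, ReachesIn r q n a := fun a =>
    let ⟨_, hab, hb⟩ := h a
    exists_reachesIn hab hb
  suffices hnext : ∀ a, ∃ b, (Nat.find (hreach a) = 0 ∧ q a ∧ b = a) ∨
      (r a b ∧ Nat.find (hreach b) < Nat.find (hreach a)) by
    choose next hnext using hnext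
    exact ⟨fun a => Nat.find (hreach a), next, hnext⟩
  intro a
  have hspec := Nat.find_spec (hreach a)
  rcases hn : Nat.find (hreach a) with _ | n
  · rw [hn] at hspec
    exact ⟨a, .inl ⟨rfl, hspec, rfl⟩⟩
  · rw [hn] at hspec
    obtain ⟨b, hab, hb⟩ := hspec
    exact ⟨b, .inr ⟨hab, Nat.lt_succ_of_le (Nat.find_min' (hreach b) hb)⟩⟩

end Relation

/-! ### Better replies in matching markets -/

namespace Market

variable {I J K : Type*} [LinearOrder K]

section Value

variable (u : I → J → ℝ) (κ : J → I → K)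

/-- A market: agent `i` draws utility `u i j` from position `j`, and `j` ranks the agents by
`κ j`. Agent `i` wins `j` against the proposals `b` of the others if nobody else proposing to `j`
ranks above `i`; the own proposal `b i` is irrelevant. -/
def Wins (b : I → Option J) (i : I) (j : J) : Prop :=
  ∀ k ≠ i, b k = some j → κ j k ≤ κ j i

/-- Agent `i` would profit from proposing to `j` against `b`. -/
def Achieves (b : I → Option J) (i : I) (j : J) : Prop := 0 < u i j ∧ Wins κ b i j

open scoped Classical in
/-- Ordinal payoff of the reply `x` of `i` to `b`: any useless proposal costs one unit, in
accordance with the negotiation cost of the algorithm. -/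
def value (b : I → Option J) (i : I) : Option J → ℝ
  | none => 0
  | some j => if Achieves u κ b i j then u i j else -1

/-- The reply `x` of `i` is not a proposal to an unacceptable partner. -/
def Acceptable (i : I) (x : Option J) : Prop := ∀ j, x = some j → 0 < u i j

/-- One agent revises its proposal. Moves to strictly better replies are restricted to profiles
of acceptable proposals, because only there do the agents of the algorithm know the offers of
their rivals; before, they withdraw from unacceptable partners. -/
def Step [DecidableEq I] (b b' : I → Option J) : Prop :=
  ∃ i x, b' = Function.update b i x ∧
    ((¬ Acceptable u i (b i) ∧ x = none) ∨
      ((∀ k, Acceptable u k (b k)) ∧ value u κ b i (b i) < value u κ b i x))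

/-- No agent has a better reply. -/
def IsEquilibrium (b : I → Option J) : Prop := ∀ i x, value u κ b i x ≤ value u κ b i (b i)

/-- No proposing agent has a better reply. -/
def IsSettled (b : I → Option J) : Prop :=
  ∀ i, b i ≠ none → ∀ x, value u κ b i x ≤ value u κ b i (b i)

end Value

variable {u : I → J → ℝ} {κ : J → I → K} {b c : I → Option J} {i k : I} {j l : J} {x : Option J}

@[simp] theorem value_none : value u κ b i none = 0 := rfl

theorem value_some_of_achieves (h : Achieves u κ b i j) : value u κ b i (some j) = u i j :=
  if_pos h

theorem value_some_of_not_achieves (h : ¬ Achieves u κ b i j) : value u κ b i (some j) = -1 :=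
  if_neg h

theorem value_some_nonneg_iff : 0 ≤ value u κ b i (some j) ↔ Achieves u κ b i j := by
  by_cases h : Achieves u κ b i j
  · simp [value_some_of_achieves h, h, h.1.le]
  · simp [value_some_of_not_achieves h, h]

theorem exists_achieves_of_value_pos (h : 0 < value u κ b i x) :
    ∃ j, x = some j ∧ Achieves u κ b i j := by
  cases x with
  | none => exact absurd h (lt_irrefl _)
  | some j => exact ⟨j, rfl, value_some_nonneg_iff.1 h.le⟩

theorem value_le_of_achieves_imp (h : ∀ j, Achieves u κ b i j → Achieves u κ c i j) :
    value u κ b i x ≤ value u κ c i x := by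
  cases x with
  | none => exact le_rfl
  | some j =>
    by_cases hb : Achieves u κ b i j
    · rw [value_some_of_achieves hb, value_some_of_achieves (h j hb)]
    · by_cases hc : Achieves u κ c i j
      · rw [value_some_of_not_achieves hb, value_some_of_achieves hc]
        linarith [hc.1]
      · rw [value_some_of_not_achieves hb, value_some_of_not_achieves hc]

theorem IsSettled.achieves (h : IsSettled u κ b) (hi : b i = some j) : Achieves u κ b i j :=
  value_some_nonneg_iff.1 (hi ▸ h i (by simp [hi]) none)

theorem IsSettled.acceptable (h : IsSettled u κ b) (i : I) : Acceptable u i (b i) :=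
  fun _ hi => (h.achieves hi).1

theorem IsEquilibrium.isSettled (h : IsEquilibrium u κ b) : IsSettled u κ b := fun i _ => h i

theorem IsSettled.eq_of_eq_some (hκ : ∀ j, Function.Injective (κ j)) (h : IsSettled u κ b)
    (hi : b i = some j) (hk : b k = some j) : i = k := by
  by_contra hik
  exact hik (hκ j (le_antisymm ((h.achieves hk).2 i hik hi)
    ((h.achieves hi).2 k (Ne.symm hik) hk)))

section Settling

variable [Fintype J]

open scoped Classical in
/-- Position of the reply `x` in the ranking of `i`, not proposing being counted best. -/
def position (u : I → J → ℝ) (i : I) : Option J → ℕ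
  | none => 0
  | some j => 1 + (Finset.univ.filter fun j' => u i j < u i j').card

theorem position_none_lt (hx : x ≠ none) : position u i none < position u i x := by
  obtain ⟨j, rfl⟩ := Option.ne_none_iff_exists'.1 hx
  simp [position]

theorem position_some_lt (h : u i j < u i l) :
    position u i (some l) < position u i (some j) := by
  classical
  refine Nat.add_lt_add_left (Finset.card_lt_card ?_) 1
  refine Finset.ssubset_iff_of_subset (Finset.monotone_filter_right _ fun _ _ => h.trans) |>.2
    ⟨l, by simpa using h, by simp⟩

variable [Fintype I] [DecidableEq I]

theorem sum_position_update_lt (h : position u i x < position u i (b i)) :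
    ∑ k, position u k (Function.update b i x k) < ∑ k, position u k (b k) := by
  refine Finset.sum_lt_sum (fun k _ => ?_) ⟨i, Finset.mem_univ i, by simpa using h⟩
  rcases eq_or_ne k i with rfl | hk
  · simpa using h.le
  · rw [Function.update_of_ne hk]

theorem exists_step_of_not_isSettled (hb : ¬ IsSettled u κ b) :
    ∃ b', Step u κ b b' ∧ ∑ k, position u k (b' k) < ∑ k, position u k (b k) := by
  by_cases hacc : ∀ k, Acceptable u k (b k)
  · simp only [IsSettled, not_forall, not_le] at hb
    obtain ⟨i, hi, x, hlt⟩ := hb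
    obtain ⟨j, hij⟩ := Option.ne_none_iff_exists'.1 hi
    by_cases hach : Achieves u κ b i j
    · refine ⟨_, ⟨i, x, rfl, .inr ⟨hacc, hlt⟩⟩, sum_position_update_lt ?_⟩
      rw [hij, value_some_of_achieves hach] at hlt
      obtain ⟨l, rfl, hl⟩ := exists_achieves_of_value_pos (hach.1.trans hlt)
      rw [value_some_of_achieves hl] at hlt
      exact hij ▸ position_some_lt hlt
    · refine ⟨_, ⟨i, none, rfl, .inr ⟨hacc, ?_⟩⟩, sum_position_update_lt (position_none_lt hi)⟩
      rw [hij, value_some_of_not_achieves hach]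
      simp
  · obtain ⟨i, hi⟩ := not_forall.1 hacc
    refine ⟨_, ⟨i, none, rfl, .inl ⟨hi, rfl⟩⟩, sum_position_update_lt (position_none_lt ?_)⟩
    rintro hnone
    simp [Acceptable, hnone] at hi

end Settling

theorem exists_isSettled [Finite I] [Finite J] [DecidableEq I] (b : I → Option J) :
    ∃ b', Relation.ReflTransGen (Step u κ) b b' ∧ IsSettled u κ b' := by
  cases nonempty_fintype I
  cases nonempty_fintype J
  obtain ⟨b', hbb', -, hb'⟩ := exists_reflTransGen_of_descent (r := Step u κ)
    (p := fun _ => True) (q := IsSettled u κ) (fun b => ∑ k, position u k (b k))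
    (fun b _ hb =>
      let ⟨b', hstep, hlt⟩ := exists_step_of_not_isSettled hb
      ⟨b', .single hstep, trivial, hlt⟩) b trivial
  exact ⟨b', hbb', hb'⟩

theorem IsSettled.exists_best_achievable [Finite J] (hb : IsSettled u κ b)
    (hne : ¬ IsEquilibrium u κ b) :
    ∃ i j, b i = none ∧ Achieves u κ b i j ∧ ∀ l, Achieves u κ b i l → u i l ≤ u i j := by
  simp only [IsEquilibrium, not_forall, not_le] at hne
  obtain ⟨i, x, hlt⟩ := hne
  have hi : b i = none := by
    by_contra hi
    exact (hb i hi x).not_gt hlt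
  rw [hi, value_none] at hlt
  obtain ⟨l, -, hl⟩ := exists_achieves_of_value_pos hlt
  obtain ⟨j, hj, hmax⟩ := Set.exists_max_image {l | Achieves u κ b i l} (u i)
    (Set.toFinite _) ⟨l, hl⟩
  exact ⟨i, j, hi, hj, hmax⟩

section Displace

variable [DecidableEq I] [DecidableEq J]

/-- The idle agent `i` takes `j`, and whoever held `j` becomes idle. -/
def displace (b : I → Option J) (i : I) (j : J) : I → Option J :=
  fun k => if k = i then some j else if b k = some j then none else b k

theorem displace_eq_some_self_iff : displace b i j k = some j ↔ k = i := by
  unfold displace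
  split_ifs <;> simp [*]

theorem displace_eq_some_iff_of_ne (hi : b i = none) (hl : l ≠ j) :
    displace b i j k = some l ↔ b k = some l := by
  unfold displace
  split_ifs with hk hb
  · simp [hk, hi, hl.symm]
  · simp [hb, hl.symm]
  · rfl

theorem reflTransGen_step_displace (hκ : ∀ j, Function.Injective (κ j)) (hb : IsSettled u κ b)
    (hi : b i = none) (hj : Achieves u κ b i j) :
    Relation.ReflTransGen (Step u κ) b (displace b i j) := by
  have hpropose : Step u κ b (Function.update b i (some j)) := by
    refine ⟨i, some j, rfl, .inr ⟨hb.acceptable, ?_⟩⟩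
    rw [hi, value_none, value_some_of_achieves hj]
    exact hj.1
  by_cases hheld : ∃ k, b k = some j
  · obtain ⟨k, hk⟩ := hheld
    have hki : k ≠ i := by rintro rfl; simp [hi] at hk
    refine .tail (.single hpropose) ⟨k, none, ?_, .inr ⟨fun k' => ?_, ?_⟩⟩
    · ext1 k'
      simp only [displace, Function.update_apply]
      split_ifs with h₁ h₂ h₃ h₄ h₄
      · exact absurd (h₂.symm.trans h₁) hki
      · rfl
      · rfl
      · exact absurd (hb.eq_of_eq_some hκ h₃ hk) h₄
      · exact absurd (h₄ ▸ hk) h₃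
      · rfl
    · rcases eq_or_ne k' i with rfl | hk'
      · simpa [Acceptable] using hj.1
      · rw [Function.update_of_ne hk']
        exact hb.acceptable k'
    · rw [Function.update_of_ne hki, hk, value_some_of_not_achieves]
      · simp
      · rintro ⟨-, hwin⟩
        exact hki (hκ j (le_antisymm (hj.2 k hki hk) (hwin i hki.symm (by simp))))
  · convert Relation.ReflTransGen.single hpropose using 1
    ext1 k
    simp only [displace, Function.update_apply, if_neg (not_exists.1 hheld k)]

theorem achieves_of_achieves_displace (hi : b i = none) (hj : Achieves u κ b i j)
    (h : Achieves u κ (displace b i j) k l) : Achieves u κ b k l := by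
  refine ⟨h.1, fun k' hk' hbk' => ?_⟩
  rcases eq_or_ne l j with rfl | hl
  · have hk'i : k' ≠ i := by rintro rfl; simp [hi] at hbk'
    have hk'le := hj.2 k' hk'i hbk'
    rcases eq_or_ne k i with rfl | hki
    · exact hk'le
    · exact hk'le.trans (h.2 i hki.symm (displace_eq_some_self_iff.2 rfl))
  · exact h.2 k' hk' ((displace_eq_some_iff_of_ne hi hl).2 hbk')

theorem IsSettled.displace (hb : IsSettled u κ b) (hi : b i = none) (hj : Achieves u κ b i j)
    (hbest : ∀ l, Achieves u κ b i l → u i l ≤ u i j) :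
    IsSettled u κ (displace b i j) := by
  intro k hk x
  obtain ⟨l, hkl⟩ := Option.ne_none_iff_exists'.1 hk
  refine (value_le_of_achieves_imp fun _ => achieves_of_achieves_displace hi hj).trans ?_
  rw [hkl]
  rcases eq_or_ne l j with rfl | hl
  · obtain rfl := displace_eq_some_self_iff.1 hkl
    have hach : Achieves u κ (Market.displace b k l) k l :=
      ⟨hj.1, fun k' hk' h => absurd (displace_eq_some_self_iff.1 h) hk'⟩
    rw [value_some_of_achieves hach]
    rcases le_or_gt (value u κ b k x) 0 with h0 | h0
    · exact h0.trans hj.1.le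
    · obtain ⟨l', rfl, hl'⟩ := exists_achieves_of_value_pos h0
      rw [value_some_of_achieves hl']
      exact hbest l' hl'
  · have hbk := (displace_eq_some_iff_of_ne hi hl).1 hkl
    refine (hbk ▸ hb k (by simp [hbk]) x).trans (le_of_eq ?_)
    have hwins : Wins κ (Market.displace b i j) k l ↔ Wins κ b k l := by
      simp only [Wins, displace_eq_some_iff_of_ne hi hl]
    classical
    exact if_congr (and_congr_right' hwins.symm) rfl rfl

end Displace

section Equilibrium

variable [Fintype I] [Fintype J]

open scoped Classical in
/-- The pairs `(j, i)` such that `i` would strictly improve the lot of `j`: the potential that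
decreases when `j` trades up. -/
def improvers (κ : J → I → K) (b : I → Option J) : Finset (J × I) :=
  {p | ∀ k, b k = some p.1 → κ p.1 k < κ p.1 p.2}

theorem mem_improvers : (j, i) ∈ improvers κ b ↔ ∀ k, b k = some j → κ j k < κ j i := by
  simp [improvers]

variable [DecidableEq I] [DecidableEq J]

theorem card_improvers_displace_lt (hκ : ∀ j, Function.Injective (κ j)) (hi : b i = none)
    (hj : Wins κ b i j) :
    (improvers κ (displace b i j)).card < (improvers κ b).card := by
  have hlt : ∀ k, b k = some j → κ j k < κ j i := fun k hk => by
    have hki : k ≠ i := by rintro rfl; simp [hi] at hk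
    exact lt_of_le_of_ne (hj k hki hk) ((hκ j).ne hki)
  refine Finset.card_lt_card (Finset.ssubset_iff_of_subset ?_ |>.2
    ⟨(j, i), mem_improvers.2 hlt, fun h =>
      lt_irrefl _ (mem_improvers.1 h i (displace_eq_some_self_iff.2 rfl))⟩)
  rintro ⟨l, k⟩ hlk
  rw [mem_improvers] at hlk ⊢
  intro k' hk'
  rcases eq_or_ne l j with rfl | hl
  · exact (hlt k' hk').trans (hlk i (displace_eq_some_self_iff.2 rfl))
  · exact hlk k' ((displace_eq_some_iff_of_ne hi hl).2 hk')

end Equilibrium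

theorem exists_isEquilibrium [Finite I] [Finite J] [DecidableEq I]
    (hκ : ∀ j, Function.Injective (κ j)) (b : I → Option J) :
    ∃ b', Relation.ReflTransGen (Step u κ) b b' ∧ IsEquilibrium u κ b' := by
  classical
  cases nonempty_fintype I
  cases nonempty_fintype J
  obtain ⟨c, hbc, hc⟩ := exists_isSettled (u := u) (κ := κ) b
  obtain ⟨b', hcb', -, hb'⟩ := exists_reflTransGen_of_descent (r := Step u κ)
    (p := IsSettled u κ) (q := IsEquilibrium u κ) (fun b => (improvers κ b).card)
    (fun b hb hne =>
      let ⟨_, _, hi, hj, hbest⟩ := hb.exists_best_achievable hne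
      ⟨_, reflTransGen_step_displace hκ hb hi hj, hb.displace hi hj hbest,
        card_improvers_displace_lt hκ hi hj.2⟩) c hc
  exact ⟨b', hbc.trans hcb', hb'⟩

end Market

/-! ### Equilibria induce stable matchings -/

namespace Network

variable {M N : ℕ} {G : Network M N}

section Selection

variable {b : Profile M N} {m : Fin M} {n : Fin N}

theorem selects_iff_wins {a : Fin M → ℝ} {κ : Fin N → Fin M → ℝ ×ₗ ℕ}
    (hκ : ∀ k, b k = some n → κ n k = toLex (a k, G.prio n k)) :
    G.Selects b a n m ↔ b m = some n ∧ Market.Wins κ b m n := by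
  refine and_congr_right fun hm => ?_
  have hle : ∀ k, b k = some n →
      (κ n k ≤ κ n m ↔ a k < a m ∨ a k = a m ∧ G.prio n k ≤ G.prio n m) := fun k hk => by
    rw [hκ k hk, hκ m hm, Prod.Lex.toLex_le_toLex]
  refine ⟨fun h k _ hk => (hle k hk).2 (h k hk), fun h k hk => (hle k hk).1 ?_⟩
  rcases eq_or_ne k m with rfl | hkm
  · exact le_rfl
  · exact h k hkm hk

variable (G) in
/-- The key by which pair `n` ranks the CUs under the bargaining allocations: the offer first,
then the priority. -/
def merit (n : Fin N) (m : Fin M) : ℝ ×ₗ ℕ := toLex (G.alphaStar m n, G.prio n m)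

theorem merit_injective (n : Fin N) : Function.Injective (G.merit n) := fun _ _ h =>
  (G.prio n).injective (congrArg (fun p => (ofLex p).2) h)

theorem merit_le_of_alphaStar_lt {k : Fin M} (h : G.alphaStar k n < G.alphaStar m n) :
    G.merit n k ≤ G.merit n m :=
  Prod.Lex.toLex_le_toLex.2 (.inl h)

theorem selects_trueOffer_iff :
    G.Selects b (G.trueOffer b) n m ↔ b m = some n ∧ Market.Wins G.merit b m n :=
  selects_iff_wins fun k hk => by simp [merit, trueOffer, hk]

end Selection

theorem Standing.RD_nonneg (hG : G.Standing) (m : Fin M) (n : Fin N) : 0 ≤ G.RD m n := by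
  refine integral_nonneg_of_ae ?_
  filter_upwards [hG.gains_nonneg] with g hg
  have hgain : 0 ≤ G.pd * g.2.2 m n / G.n0 :=
    div_nonneg (mul_nonneg hG.pd_pos.le (hg.2.2 m n)) hG.n0_pos.le
  exact Real.log_nonneg (by linarith)

theorem Standing.RD_eq (hG : G.Standing) (m m' : Fin M) (n : Fin N) :
    G.RD m n = G.RD m' n := by
  have hrate : Measurable fun x : ℝ => Real.log (1 + G.pd * x / G.n0) := by fun_prop
  have hRD : ∀ k, G.RD k n =
      ∫ x, Real.log (1 + G.pd * x / G.n0) ∂(G.law.map fun g => g.2.2 k n) := fun k => by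
    rw [integral_map (by fun_prop) hrate.aestronglyMeasurable]
    rfl
  rw [hRD, hRD, hG.d2d_ident n m m']

theorem alphaStar_lt_of_d2dValue_lt (hG : G.Standing) {m k : Fin M} {n : Fin N}
    (h : G.d2dValue n (some k) < G.d2dValue n (some m)) :
    G.alphaStar k n < G.alphaStar m n := by
  simp only [d2dValue, UDstar, UD, hG.RD_eq k m n] at h
  exact lt_of_mul_lt_mul_right h (hG.RD_nonneg m n)

section Equilibrium

variable {b : Profile M N} (hb : Market.IsEquilibrium G.UCstar G.merit b)
include hb

theorem choice_eq_some_iff_of_isEquilibrium {m : Fin M} {n : Fin N} :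
    G.choice b (G.trueOffer b) n = some m ↔ b m = some n := by
  rw [choice_eq_some_iff, selects_trueOffer_iff]
  exact ⟨And.left, fun h => ⟨h, (hb.isSettled.achieves h).2⟩⟩

theorem matching_eq_of_isEquilibrium (m : Fin M) : G.matching b m = b m := by
  change (if ∃ n, b m = some n ∧ G.choice b (G.trueOffer b) n = some m then b m else none) = b m
  simp only [choice_eq_some_iff_of_isEquilibrium hb, and_self]
  cases b m <;> simp

theorem cuValue_eq_of_isEquilibrium (m : Fin M) :
    G.cuValue m (b m) = Market.value G.UCstar G.merit b m (b m) := by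
  rcases hbm : b m with _ | n
  · rfl
  · exact (Market.value_some_of_achieves (hb.isSettled.achieves hbm)).symm

theorem isStable_of_isEquilibrium (hG : G.Standing) : G.IsStable (G.matching b) := by
  refine ⟨fun m n hmn => ?_, ?_⟩
  · rw [matching_eq_of_isEquilibrium hb] at hmn
    exact (hb.isSettled.achieves hmn).1
  · rintro ⟨m, n, -, hd2d, hcu⟩
    rw [matching_eq_of_isEquilibrium hb, cuValue_eq_of_isEquilibrium hb] at hcu
    have hpos : 0 < G.UCstar m n := (hb m none).trans_lt hcu
    have hwins : Market.Wins G.merit b m n := fun k _ hk => by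
      change G.d2dValue n (G.choice b (G.trueOffer b) n) < _ at hd2d
      rw [(choice_eq_some_iff_of_isEquilibrium hb).2 hk] at hd2d
      exact merit_le_of_alphaStar_lt (alphaStar_lt_of_d2dValue_lt hG hd2d)
    have hle := hb m (some n)
    rw [Market.value_some_of_achieves ⟨hpos, hwins⟩] at hle
    exact hle.not_gt hcu

end Equilibrium

end Network

/-! ### The strong law of large numbers under optional skipping -/

section OptionalSkipping

variable {Ω β : Type*} {mΩ : MeasurableSpace Ω}

open scoped Classical in
/-- The event that `t` is the `j`-th of the times `τ` (counted from `0`) at which `s τ` occurs. -/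
def nthEvent (s : ℕ → Set Ω) (j t : ℕ) : Set Ω :=
  {ω | ω ∈ s t ∧ Nat.count (fun τ => ω ∈ s τ) t = j}

/-- The sequence `r` sampled at the `j`-th of the times `τ` at which `s τ` occurs; by the
convention of `Nat.nth` it is `r 0` if there are not that many. -/
def sampled (s : ℕ → Set Ω) (r : ℕ → Ω → β) (j : ℕ) (ω : Ω) : β :=
  r (Nat.nth (fun τ => ω ∈ s τ) j) ω

section Paths

variable {s : ℕ → Set Ω} {i j t : ℕ} {ω : Ω}

theorem nth_eq_of_mem_nthEvent (h : ω ∈ nthEvent s j t) :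
    Nat.nth (fun τ => ω ∈ s τ) j = t := by
  classical
  rw [← h.2]
  exact Nat.nth_count (p := fun τ => ω ∈ s τ) h.1

theorem sampled_eq_of_mem_nthEvent {r : ℕ → Ω → β} (h : ω ∈ nthEvent s j t) :
    sampled s r j ω = r t ω := by
  rw [sampled, nth_eq_of_mem_nthEvent h]

theorem mem_nthEvent_nth (h : {t | ω ∈ s t}.Infinite) :
    ω ∈ nthEvent s j (Nat.nth (fun τ => ω ∈ s τ) j) := by
  classical exact ⟨Nat.nth_mem_of_infinite h j, Nat.count_nth_of_infinite h j⟩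

theorem mem_nthEvent_nth_of_ne_zero (h : Nat.nth (fun τ => ω ∈ s τ) j ≠ 0) :
    ω ∈ nthEvent s j (Nat.nth (fun τ => ω ∈ s τ) j) := by
  classical exact ⟨Nat.nth_mem_of_ne_zero h, Nat.count_nth (Nat.lt_card_toFinset_of_nth_ne_zero h)⟩

theorem exists_mem_nthEvent_of_lt (h : ω ∈ nthEvent s j t) (hij : i < j) :
    ∃ u < t, ω ∈ nthEvent s i u := by
  classical
  obtain ⟨n, hn, hnt⟩ := Nat.exists_lt_card_nth_eq (p := fun τ => ω ∈ s τ) h.1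
  obtain rfl : n = j := by rw [← Nat.count_nth hn, hnt]; exact h.2
  have hi : ∀ hf : {τ | ω ∈ s τ}.Finite, i < hf.toFinset.card := fun hf => hij.trans (hn hf)
  refine ⟨_, Nat.nth_lt_of_lt_count (p := fun τ => ω ∈ s τ) (n := t) ?_,
    Nat.nth_mem i hi, Nat.count_nth hi⟩
  exact hij.trans_eq h.2.symm

theorem tendsto_count_atTop {p : ℕ → Prop} [DecidablePred p] (h : {t | p t}.Infinite) :
    Tendsto (Nat.count p) atTop atTop :=
  tendsto_atTop_atTop.2 fun k => ⟨Nat.nth p k, fun _ hn =>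
    (Nat.count_nth_of_infinite h k).ge.trans (Nat.count_monotone p hn)⟩

open scoped Classical in
theorem sum_indicator_eq_sum_sampled {E : Type*} [AddCommMonoid E] (s : ℕ → Set Ω)
    (r : ℕ → Ω → E) (ω : Ω) (n : ℕ) :
    ∑ τ ∈ Finset.range n, (s τ).indicator (r τ) ω =
      ∑ i ∈ Finset.range (Nat.count (fun τ => ω ∈ s τ) n), sampled s r i ω := by
  induction n with
  | zero => simp
  | succ n ih =>
    rw [Finset.sum_range_succ, ih, Nat.count_succ]
    by_cases h : ω ∈ s n
    · rw [if_pos h, Finset.sum_range_succ, Set.indicator_of_mem h,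
        sampled_eq_of_mem_nthEvent (t := n) ⟨h, rfl⟩]
    · simp [h]

end Paths

theorem measurable_count {s : ℕ → Set Ω} {t : ℕ} [∀ ω, DecidablePred fun τ => ω ∈ s τ]
    (hs : ∀ τ < t, MeasurableSet (s τ)) :
    Measurable fun ω => Nat.count (fun τ => ω ∈ s τ) t := by
  induction t with
  | zero => simp
  | succ t ih =>
    simp only [Nat.count_succ]
    exact (ih fun τ hτ => hs τ (by omega)).add
      (Measurable.ite (hs t (by omega)) measurable_const measurable_const)

theorem measurableSet_nthEvent {s : ℕ → Set Ω} {t : ℕ} (hs : ∀ τ ≤ t, MeasurableSet (s τ))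
    (j : ℕ) : MeasurableSet (nthEvent s j t) := by
  classical
  exact (hs t le_rfl).inter
    (measurable_count (fun τ hτ => hs τ hτ.le) (measurableSet_singleton j))

theorem measurable_nth {s : ℕ → Set Ω} (hs : ∀ t, MeasurableSet (s t)) (j : ℕ) :
    Measurable fun ω => Nat.nth (fun τ => ω ∈ s τ) j := by
  have hpre : ∀ t ≠ 0,
      MeasurableSet ((fun ω => Nat.nth (fun τ => ω ∈ s τ) j) ⁻¹' {t}) := by
    intro t ht
    convert measurableSet_nthEvent (t := t) (fun τ _ => hs τ) j using 1
    ext ω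
    refine ⟨?_, nth_eq_of_mem_nthEvent⟩
    rintro rfl
    exact mem_nthEvent_nth_of_ne_zero ht
  refine measurable_to_countable' fun t => ?_
  rcases eq_or_ne t 0 with rfl | ht
  · convert (MeasurableSet.biUnion (Set.to_countable {t : ℕ | t ≠ 0}) hpre).compl using 1
    ext ω
    simp only [Set.mem_preimage, Set.mem_singleton_iff, Set.mem_compl_iff, Set.mem_iUnion₂]
    grind
  · exact hpre t ht

theorem measurable_sampled [MeasurableSpace β] {s : ℕ → Set Ω} (hs : ∀ t, MeasurableSet (s t))
    {r : ℕ → Ω → β} (hr : ∀ t, Measurable (r t)) (j : ℕ) : Measurable (sampled s r j) :=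
  (measurable_from_prod_countable_right (f := fun p : ℕ × Ω => r p.1 p.2) hr).comp
    ((measurable_nth hs j).prodMk measurable_id)

theorem measure_eq_tsum_nthEvent {μ : Measure Ω} {s : ℕ → Set Ω}
    (hs : ∀ t, MeasurableSet (s t)) (hinf : ∀ᵐ ω ∂μ, {t | ω ∈ s t}.Infinite) (j : ℕ)
    {A : Set Ω} (hA : MeasurableSet A) : μ A = ∑' t, μ (A ∩ nthEvent s j t) := by
  have hdisj : Pairwise (Function.onFun Disjoint fun t => A ∩ nthEvent s j t) := fun t t' htt' =>
    Set.disjoint_left.2 fun _ h h' =>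
      htt' ((nth_eq_of_mem_nthEvent h.2).symm.trans (nth_eq_of_mem_nthEvent h'.2))
  rw [← measure_iUnion hdisj fun t => hA.inter (measurableSet_nthEvent (fun τ _ => hs τ) j),
    ← Set.inter_iUnion]
  refine measure_congr ?_
  filter_upwards [hinf] with ω hω
  exact propext ⟨fun h => ⟨h, Set.mem_iUnion.2 ⟨_, mem_nthEvent_nth hω⟩⟩, And.left⟩

section Sampling

variable {μ : Measure Ω} {H : Filtration ℕ mΩ} {s : ℕ → Set Ω}

section Measurable

variable [MeasurableSpace β] {r : ℕ → Ω → β}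
  (hs : ∀ t, MeasurableSet[H t] (s t)) (hr : ∀ t, Measurable[H (t + 1)] (r t))
  (hid : ∀ t, IdentDistrib (r t) (r 0) μ μ)
  (hindep : ∀ t, Indep (MeasurableSpace.comap (r t) inferInstance) (H t) μ)
  (hinf : ∀ᵐ ω ∂μ, {t | ω ∈ s t}.Infinite)

include hs in
theorem measurableSet_nthEvent_of_adapted {t u : ℕ} (hut : u ≤ t) (j : ℕ) :
    MeasurableSet[H t] (nthEvent s j u) :=
  H.mono hut _ (measurableSet_nthEvent (mΩ := H u) (fun τ hτ => H.mono hτ _ (hs τ)) j)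

include hs hr in
theorem measurableSet_sampled_inter_nthEvent {i j : ℕ} (hij : i < j) {A : Set β}
    (hA : MeasurableSet A) (t : ℕ) :
    MeasurableSet[H t] (sampled s r i ⁻¹' A ∩ nthEvent s j t) := by
  have hunion : sampled s r i ⁻¹' A ∩ nthEvent s j t =
      (⋃ u ∈ Set.Iio t, r u ⁻¹' A ∩ nthEvent s i u) ∩ nthEvent s j t := by
    ext ω
    refine and_congr_left fun hj => ?_
    obtain ⟨u, hut, hu⟩ := exists_mem_nthEvent_of_lt hj hij
    simp only [Set.mem_preimage, Set.mem_iUnion₂, Set.mem_inter_iff]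
    refine ⟨fun h => ⟨u, hut, ?_, hu⟩, ?_⟩
    · rwa [sampled_eq_of_mem_nthEvent hu] at h
    · rintro ⟨v, -, hv, hvi⟩
      rwa [sampled_eq_of_mem_nthEvent hvi]
  rw [hunion]
  refine (MeasurableSet.biUnion (Set.to_countable _) fun u hu => ?_).inter
    (measurableSet_nthEvent_of_adapted hs le_rfl j)
  exact (H.mono (Nat.succ_le_of_lt hu) _ (hr u hA)).inter
    (measurableSet_nthEvent_of_adapted hs (le_of_lt hu) i)

include hs hr hid hindep hinf

theorem measure_inter_sampled_preimage (j : ℕ) {A : Set Ω} (hA : MeasurableSet A)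
    (hAj : ∀ t, MeasurableSet[H t] (A ∩ nthEvent s j t)) {B : Set β} (hB : MeasurableSet B) :
    μ (A ∩ sampled s r j ⁻¹' B) = μ A * μ (r 0 ⁻¹' B) := by
  have hs' : ∀ t, MeasurableSet (s t) := fun t => H.le t _ (hs t)
  have hr' : ∀ t, Measurable (r t) := fun t => (hr t).mono (H.le _) le_rfl
  rw [measure_eq_tsum_nthEvent hs' hinf j (hA.inter (measurable_sampled hs' hr' j hB)),
    measure_eq_tsum_nthEvent hs' hinf j hA, ← ENNReal.tsum_mul_right]
  refine tsum_congr fun t => ?_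
  have hset : A ∩ sampled s r j ⁻¹' B ∩ nthEvent s j t =
      r t ⁻¹' B ∩ (A ∩ nthEvent s j t) := by
    rw [← Set.inter_assoc, Set.inter_comm _ A]
    ext ω
    refine and_congr_left fun hj => and_congr_right fun _ => ?_
    rw [Set.mem_preimage, sampled_eq_of_mem_nthEvent hj, Set.mem_preimage]
  rw [hset, (Indep_iff _ _ μ).1 (hindep t) _ _ ⟨B, hB, rfl⟩ (hAj t), mul_comm,
    (hid t).measure_preimage_eq hB]

variable [IsProbabilityMeasure μ]

theorem identDistrib_sampled (j : ℕ) : IdentDistrib (sampled s r j) (r 0) μ μ := by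
  have hr' : ∀ t, Measurable (r t) := fun t => (hr t).mono (H.le _) le_rfl
  have hmeas := measurable_sampled (fun t => H.le t _ (hs t)) hr' j
  refine ⟨hmeas.aemeasurable, (hr' 0).aemeasurable, Measure.ext fun B hB => ?_⟩
  rw [Measure.map_apply hmeas hB, Measure.map_apply (hr' 0) hB]
  simpa using measure_inter_sampled_preimage hs hr hid hindep hinf j MeasurableSet.univ
    (fun t => by simpa using measurableSet_nthEvent_of_adapted hs le_rfl j) hB

theorem indepFun_sampled_of_lt {i j : ℕ} (hij : i < j) :
    IndepFun (sampled s r i) (sampled s r j) μ := by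
  refine indepFun_iff_measure_inter_preimage_eq_mul.2 fun A B hA hB => ?_
  have hmeas := measurable_sampled (fun t => H.le t _ (hs t))
    (fun t => (hr t).mono (H.le _) le_rfl) i hA
  rw [measure_inter_sampled_preimage hs hr hid hindep hinf j hmeas
      (measurableSet_sampled_inter_nthEvent hs hr hij hA) hB,
    (identDistrib_sampled hs hr hid hindep hinf j).measure_preimage_eq hB]

theorem pairwise_indepFun_sampled :
    Pairwise (Function.onFun (fun X Y => IndepFun X Y μ) (sampled s r)) := fun i j hij => by
  rcases lt_or_gt_of_ne hij with h | h
  · exact indepFun_sampled_of_lt hs hr hid hindep hinf h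
  · exact (indepFun_sampled_of_lt hs hr hid hindep hinf h).symm

end Measurable

open scoped Classical in
theorem strong_law_optional_skipping [IsProbabilityMeasure μ] {E : Type*}
    [NormedAddCommGroup E] [NormedSpace ℝ E] [CompleteSpace E] [MeasurableSpace E]
    [BorelSpace E] {r : ℕ → Ω → E} (hs : ∀ t, MeasurableSet[H t] (s t))
    (hr : ∀ t, Measurable[H (t + 1)] (r t)) (hid : ∀ t, IdentDistrib (r t) (r 0) μ μ)
    (hindep : ∀ t, Indep (MeasurableSpace.comap (r t) inferInstance) (H t) μ)
    (hinf : ∀ᵐ ω ∂μ, {t | ω ∈ s t}.Infinite) (hint : Integrable (r 0) μ) :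
    ∀ᵐ ω ∂μ, Tendsto (fun n => (Nat.count (fun τ => ω ∈ s τ) n : ℝ)⁻¹ •
      ∑ τ ∈ Finset.range n, (s τ).indicator (r τ) ω) atTop (𝓝 (∫ ω, r 0 ω ∂μ)) := by
  have hident := identDistrib_sampled hs hr hid hindep hinf
  have hlaw := strong_law_ae (sampled s r) ((hident 0).integrable_iff.2 hint)
    (pairwise_indepFun_sampled hs hr hid hindep hinf) fun i => (hident i).trans (hident 0).symm
  filter_upwards [hlaw, hinf] with ω hω hωinf
  rw [(hident 0).integral_eq] at hω
  simp only [sum_indicator_eq_sum_sampled]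
  exact hω.comp (tendsto_count_atTop hωinf)

end Sampling

end OptionalSkipping

/-! ### A drift criterion -/

theorem tendsto_zero_of_contraction {v e : ℕ → ℝ} {δ : ℝ} (hδ : 0 < δ) (hδ1 : δ ≤ 1)
    (hv : ∀ t, 0 ≤ v t) (he : Tendsto e atTop (𝓝 0))
    (h : ∀ᶠ t in atTop, v (t + 1) ≤ (1 - δ) * v t + e t) : Tendsto v atTop (𝓝 0) := by
  refine tendsto_order.2 ⟨fun a ha => Eventually.of_forall fun t => ha.trans_le (hv t),
    fun a ha => ?_⟩
  have hsmall : ∀ᶠ t in atTop, e t < δ * (a / 2) := he.eventually_lt_const (by positivity)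
  obtain ⟨T, hT⟩ := eventually_atTop.1 (hsmall.and h)
  have hrec : ∀ n, v (T + n) ≤ a / 2 + (1 - δ) ^ n * v T := by
    intro n
    induction n with
    | zero => simp only [add_zero, pow_zero, one_mul]; linarith
    | succ n ih =>
      obtain ⟨he', hv'⟩ := hT (T + n) (by omega)
      have := mul_le_mul_of_nonneg_left ih (sub_nonneg.2 hδ1)
      rw [← add_assoc, pow_succ]
      linarith
  have hlim : Tendsto (fun n => a / 2 + (1 - δ) ^ n * v T) atTop (𝓝 (a / 2 + 0 * v T)) :=
    ((tendsto_pow_atTop_nhds_zero_of_lt_one (by linarith) (by linarith)).mul_const _).const_add _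
  obtain ⟨n, hn⟩ := eventually_atTop.1
    (hlim.eventually_lt_const (by linarith : a / 2 + 0 * v T < a))
  refine eventually_atTop.2 ⟨T + n, fun t ht => ?_⟩
  obtain ⟨k, rfl⟩ := Nat.exists_eq_add_of_le (show T ≤ t by omega)
  exact (hrec k).trans_lt (hn k (by omega))

section Drift

variable {Ω : Type*} {mΩ : MeasurableSpace Ω} {μ : Measure Ω}

theorem setIntegral_le_setIntegral_of_fibers {f g : Ω → ℝ} {Z : Ω → ℕ} {B : Set Ω}
    (hf : Integrable f μ) (hg : Integrable g μ) (hZ : Measurable Z) (hB : MeasurableSet B)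
    (h : ∀ k, ∫ ω in B ∩ Z ⁻¹' {k}, f ω ∂μ ≤ ∫ ω in B ∩ Z ⁻¹' {k}, g ω ∂μ) :
    ∫ ω in B, f ω ∂μ ≤ ∫ ω in B, g ω ∂μ := by
  have hfib : ∀ k, MeasurableSet (B ∩ Z ⁻¹' {k}) := fun k =>
    hB.inter (hZ (measurableSet_singleton k))
  have hdisj : Pairwise (Function.onFun Disjoint fun k => B ∩ Z ⁻¹' {k}) := fun k l hkl =>
    Set.disjoint_left.2 fun _ hk hl => hkl (hk.2.symm.trans hl.2)
  have hunion : ⋃ k, B ∩ Z ⁻¹' {k} = B := by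
    ext ω
    simp
  rw [← hunion]
  exact hasSum_le h (hasSum_integral_iUnion hfib hdisj hf.integrableOn)
    (hasSum_integral_iUnion hfib hdisj hg.integrableOn)

theorem setIntegral_le_measureReal_sub [IsFiniteMeasure μ] {f : Ω → ℝ} {c : ℝ} {E F : Set Ω}
    (hf : Integrable f μ) (hf1 : ∀ ω, f ω ≤ 1) (hF : MeasurableSet F)
    (hfF : ∀ ω ∈ F, f ω ≤ 1 - c) :
    ∫ ω in E, f ω ∂μ ≤ μ.real E - c * μ.real (E ∩ F) := by
  have hind : Integrable (F.indicator fun _ => c) (μ.restrict E) :=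
    (integrable_const c).indicator hF
  calc ∫ ω in E, f ω ∂μ ≤ ∫ ω in E, (1 - F.indicator (fun _ => c) ω) ∂μ := by
        refine integral_mono hf.integrableOn ((integrable_const 1).sub hind) fun ω => ?_
        by_cases hω : ω ∈ F
        · simpa [hω] using hfF ω hω
        · simpa [hω] using hf1 ω
    _ = μ.real E - c * μ.real (E ∩ F) := by
        rw [integral_sub (integrable_const 1) hind, integral_indicator_const _ hF]
        simp [measureReal_restrict_apply hF, Set.inter_comm, mul_comm]

/-- The Lyapunov function of the drift criterion: with this geometric choice, a drop of `n` with
probability `q` outweighs any rise that happens with the remaining probability. -/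
def driftWeight (q : ℝ) (n : ℕ) : ℝ :=
  1 - (q / 2) ^ n

section Weight

variable {q : ℝ} (hq : 0 < q) (hq1 : q ≤ 1)
include hq

theorem driftWeight_le_one (n : ℕ) : driftWeight q n ≤ 1 :=
  sub_le_self _ (by positivity)

include hq1

theorem driftWeight_mono : Monotone (driftWeight q) := fun _ _ hmn =>
  sub_le_sub_left (pow_le_pow_of_le_one (by positivity) (by linarith) hmn) 1

theorem driftWeight_nonneg (n : ℕ) : 0 ≤ driftWeight q n := by
  simpa [driftWeight] using driftWeight_mono hq hq1 n.zero_le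

theorem half_le_driftWeight {n : ℕ} (hn : n ≠ 0) : 1 / 2 ≤ driftWeight q n :=
  le_trans (by rw [driftWeight]; linarith [pow_one (q / 2)])
    (driftWeight_mono hq hq1 (Nat.one_le_iff_ne_zero.2 hn))

theorem integrable_driftWeight [IsFiniteMeasure μ] {Z : Ω → ℕ} (hZ : Measurable Z) :
    Integrable (fun ω => driftWeight q (Z ω)) μ :=
  Integrable.of_mem_Icc 0 1 ((measurable_from_top (f := driftWeight q)).comp hZ).aemeasurable <|
    Eventually.of_forall fun _ =>
      ⟨driftWeight_nonneg hq hq1 _, driftWeight_le_one hq _⟩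

variable [IsFiniteMeasure μ] {Z' : Ω → ℕ} (hZ' : Measurable Z') {E : Set Ω} {k K : ℕ}
include hZ'

theorem setIntegral_driftWeight_le_of_drop (hk : k ≠ 0) (hkK : k ≤ K)
    (hdown : q * μ.real E ≤ μ.real (E ∩ {ω | Z' ω < k})) :
    ∫ ω in E, driftWeight q (Z' ω) ∂μ ≤
      (1 - (q / 2) ^ K) * (driftWeight q k * μ.real E) := by
  obtain ⟨l, rfl⟩ := Nat.exists_eq_succ_of_ne_zero hk
  have hint := setIntegral_le_measureReal_sub (E := E) (F := {ω | Z' ω < l + 1})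
    (c := (q / 2) ^ l) (integrable_driftWeight (μ := μ) hq hq1 hZ')
    (fun ω => driftWeight_le_one hq _) (hZ' (Set.to_countable (Set.Iio (l + 1))).measurableSet)
    fun ω hω => driftWeight_mono hq hq1 (Nat.lt_succ_iff.1 hω)
  have hδ : (q / 2) ^ K ≤ (q / 2) ^ (l + 1) :=
    pow_le_pow_of_le_one (by positivity) (by linarith) hkK
  have hweight : 1 - (q / 2) ^ l * q ≤ (1 - (q / 2) ^ K) * driftWeight q (l + 1) := by
    have : 0 < (q / 2) ^ K * (q / 2) ^ (l + 1) := by positivity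
    rw [driftWeight]
    linarith [pow_succ (q / 2) l]
  have hE := mul_le_mul_of_nonneg_right hweight (measureReal_nonneg (μ := μ) (s := E))
  have hdrop := mul_le_mul_of_nonneg_left hdown (by positivity : 0 ≤ (q / 2) ^ l)
  linarith

theorem setIntegral_driftWeight_le_of_stay {p : ℝ}
    (hstay : p * μ.real E ≤ μ.real (E ∩ {ω | Z' ω = 0})) :
    ∫ ω in E, driftWeight q (Z' ω) ∂μ ≤ (1 - p) * μ.real E := by
  have hint := setIntegral_le_measureReal_sub (E := E) (F := {ω | Z' ω = 0}) (c := 1)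
    (integrable_driftWeight (μ := μ) hq hq1 hZ') (fun ω => driftWeight_le_one hq _)
    (hZ' (measurableSet_singleton 0)) fun ω (hω : Z' ω = 0) => by rw [hω, driftWeight, pow_zero]
  linarith

theorem setIntegral_driftWeight_le_of_drift {p : ℝ} (hkK : k ≤ K)
    (hdown : k ≠ 0 → q * μ.real E ≤ μ.real (E ∩ {ω | Z' ω < k}))
    (hstay : k = 0 → p * μ.real E ≤ μ.real (E ∩ {ω | Z' ω = 0})) :
    ∫ ω in E, driftWeight q (Z' ω) ∂μ ≤
      ((1 - (q / 2) ^ K) * driftWeight q k + |1 - p|) * μ.real E := by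
  have hμ := measureReal_nonneg (μ := μ) (s := E)
  rcases eq_or_ne k 0 with rfl | hk
  · have hweight : driftWeight q 0 = 0 := by simp [driftWeight]
    rw [hweight, mul_zero, zero_add]
    exact (setIntegral_driftWeight_le_of_stay hq hq1 hZ' (hstay rfl)).trans
      (mul_le_mul_of_nonneg_right (le_abs_self _) hμ)
  · have := setIntegral_driftWeight_le_of_drop hq hq1 hZ' hk hkK (hdown hk)
    linarith [mul_nonneg (abs_nonneg (1 - p)) hμ]

theorem half_mul_measureReal_le_setIntegral_driftWeight (hE : MeasurableSet E) :
    1 / 2 * μ.real (E ∩ {ω | Z' ω ≠ 0}) ≤ ∫ ω in E, driftWeight q (Z' ω) ∂μ := by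
  have hint := (integrable_driftWeight (μ := μ) hq hq1 hZ').integrableOn (s := E)
  calc 1 / 2 * μ.real (E ∩ {ω | Z' ω ≠ 0})
      ≤ ∫ ω in E ∩ {ω | Z' ω ≠ 0}, driftWeight q (Z' ω) ∂μ :=
        setIntegral_ge_of_const_le_real
          (hE.inter (hZ' (measurableSet_singleton 0)).compl) (measure_ne_top _ _)
          (fun ω hω => half_le_driftWeight hq hq1 hω.2) (hint.mono_set Set.inter_subset_left)
    _ ≤ ∫ ω in E, driftWeight q (Z' ω) ∂μ :=
        setIntegral_mono_set hint (Eventually.of_forall fun ω => driftWeight_nonneg hq hq1 _)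
          Set.inter_subset_left.eventuallyLE

end Weight

theorem setIntegral_driftWeight_le [IsProbabilityMeasure μ] {q p : ℝ} (hq : 0 < q)
    (hq1 : q ≤ 1) {Z Z' : Ω → ℕ} (hZ : Measurable Z) (hZ' : Measurable Z') {K : ℕ}
    (hK : ∀ ω, Z ω ≤ K) {B : Set Ω} (hB : MeasurableSet B)
    (hdown : ∀ k ≠ 0, q * μ.real (B ∩ Z ⁻¹' {k}) ≤ μ.real (B ∩ Z ⁻¹' {k} ∩ {ω | Z' ω < k}))
    (hstay : p * μ.real (B ∩ Z ⁻¹' {0}) ≤ μ.real (B ∩ Z ⁻¹' {0} ∩ {ω | Z' ω = 0})) :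
    ∫ ω in B, driftWeight q (Z' ω) ∂μ ≤
      (1 - (q / 2) ^ K) * ∫ ω in B, driftWeight q (Z ω) ∂μ + |1 - p| := by
  have hint := integrable_driftWeight (μ := μ) hq hq1 hZ
  have hbound : Integrable (fun ω => (1 - (q / 2) ^ K) * driftWeight q (Z ω) + |1 - p|) μ :=
    (hint.const_mul _).add (integrable_const _)
  have hfib : ∀ k, ∫ ω in B ∩ Z ⁻¹' {k}, ((1 - (q / 2) ^ K) * driftWeight q (Z ω) + |1 - p|) ∂μ =
      ((1 - (q / 2) ^ K) * driftWeight q k + |1 - p|) * μ.real (B ∩ Z ⁻¹' {k}) := by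
    intro k
    rw [setIntegral_congr_fun (hB.inter (hZ (measurableSet_singleton k)))
      (g := fun _ => (1 - (q / 2) ^ K) * driftWeight q k + |1 - p|)
      fun ω hω => by simp only [Set.mem_singleton_iff.1 hω.2]]
    rw [setIntegral_const, smul_eq_mul, mul_comm]
  have hle : ∫ ω in B, driftWeight q (Z' ω) ∂μ ≤
      ∫ ω in B, ((1 - (q / 2) ^ K) * driftWeight q (Z ω) + |1 - p|) ∂μ := by
    refine setIntegral_le_setIntegral_of_fibers (integrable_driftWeight hq hq1 hZ') hbound hZ hB
      fun k => ?_
    rw [hfib]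
    rcases le_or_gt k K with hkK | hkK
    · exact setIntegral_driftWeight_le_of_drift hq hq1 hZ' hkK (hdown k) fun hk => by
        subst hk
        exact hstay
    · have hempty : B ∩ Z ⁻¹' {k} = ∅ :=
        Set.eq_empty_of_forall_notMem fun ω hω => (hkK.trans_eq hω.2.symm).not_ge (hK ω)
      simp [hempty]
  refine hle.trans ?_
  rw [integral_add (hint.const_mul _).integrableOn (integrable_const _), integral_const_mul,
    setIntegral_const, smul_eq_mul]
  have := mul_le_mul_of_nonneg_right (measureReal_le_one (μ := μ) (s := B)) (abs_nonneg (1 - p))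
  linarith

variable [IsProbabilityMeasure μ] {A : ℕ → Set Ω}

/-- The event that `A τ` occurs at all times `τ` from `T` to `t`. -/
def goodSince (A : ℕ → Set Ω) (T t : ℕ) : Set Ω :=
  ⋂ τ ∈ Set.Icc T t, A τ

theorem tendsto_measureReal_of_goodSince {S : ℕ → Set Ω} (hA : ∀ t, MeasurableSet (A t))
    (hev : ∀ᵐ ω ∂μ, ∀ᶠ t in atTop, ω ∈ A t)
    (h : ∀ T, Tendsto (fun t => μ.real (goodSince A T t ∩ S t)) atTop (𝓝 0)) :
    Tendsto (fun t => μ.real (S t)) atTop (𝓝 0) := by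
  have hanti : Antitone fun T => ⋃ t ∈ Set.Ici T, (A t)ᶜ := fun T T' hTT' =>
    Set.biUnion_subset_biUnion_left (Set.Ici_subset_Ici.2 hTT')
  have hbad : Tendsto (fun T => μ.real (⋃ t ∈ Set.Ici T, (A t)ᶜ)) atTop (𝓝 0) := by
    have hnull : μ (⋂ T, ⋃ t ∈ Set.Ici T, (A t)ᶜ) = 0 := by
      refine measure_mono_null (fun ω hω => ?_) (mem_ae_iff.1 hev)
      rintro (hev : ∀ᶠ t in atTop, ω ∈ A t)
      obtain ⟨T, hT⟩ := eventually_atTop.1 hev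
      obtain ⟨t, ht, htA⟩ := Set.mem_iUnion₂.1 (Set.mem_iInter.1 hω T)
      exact htA (hT t ht)
    have := tendsto_measure_iInter_atTop (μ := μ)
      (fun T => (MeasurableSet.biUnion (Set.to_countable (Set.Ici T))
        fun t _ => (hA t).compl).nullMeasurableSet) hanti ⟨0, measure_ne_top _ _⟩
    rw [hnull] at this
    exact (ENNReal.tendsto_toReal ENNReal.zero_ne_top).comp this
  refine tendsto_order.2 ⟨fun a ha => Eventually.of_forall fun t => ha.trans_le measureReal_nonneg,
    fun a ha => ?_⟩
  obtain ⟨T, hT⟩ := (hbad.eventually_lt_const (half_pos ha)).exists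
  filter_upwards [(h T).eventually_lt_const (half_pos ha)] with t ht
  have hsub : S t ⊆ (goodSince A T t ∩ S t) ∪ ⋃ t ∈ Set.Ici T, (A t)ᶜ := by
    intro ω hω
    by_contra hn
    simp only [goodSince, Set.mem_union, Set.mem_inter_iff, Set.mem_iInter, Set.mem_iUnion,
      Set.mem_compl_iff, Set.mem_Icc, Set.mem_Ici] at hn
    grind
  calc μ.real (S t) ≤ μ.real (goodSince A T t ∩ S t) + μ.real (⋃ t ∈ Set.Ici T, (A t)ᶜ) :=
        (measureReal_mono hsub).trans (measureReal_union_le _ _)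
    _ < a := by linarith

theorem tendsto_measureReal_ne_zero_of_drift {ℱ : Filtration ℕ mΩ} {Z : ℕ → Ω → ℕ} {K : ℕ}
    {q : ℝ} {p : ℕ → ℝ} (hq : 0 < q) (hq1 : q ≤ 1) (hp : Tendsto p atTop (𝓝 1))
    (hZ : ∀ t, Measurable[ℱ t] (Z t)) (hK : ∀ t ω, Z t ω ≤ K)
    (hA : ∀ t, MeasurableSet[ℱ t] (A t)) (hev : ∀ᵐ ω ∂μ, ∀ᶠ t in atTop, ω ∈ A t)
    (hdown : ∀ᶠ t in atTop, ∀ E ⊆ A t, MeasurableSet[ℱ t] E → (∀ ω ∈ E, Z t ω ≠ 0) →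
      q * μ.real E ≤ μ.real (E ∩ {ω | Z (t + 1) ω < Z t ω}))
    (hstay : ∀ᶠ t in atTop, ∀ E ⊆ A t, MeasurableSet[ℱ t] E → (∀ ω ∈ E, Z t ω = 0) →
      p t * μ.real E ≤ μ.real (E ∩ {ω | Z (t + 1) ω = 0})) :
    Tendsto (fun t => μ.real {ω | Z t ω ≠ 0}) atTop (𝓝 0) := by
  have hZ' : ∀ t, Measurable (Z t) := fun t => (hZ t).mono (ℱ.le t) le_rfl
  refine tendsto_measureReal_of_goodSince (fun t => ℱ.le t _ (hA t)) hev fun T => ?_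
  have hB : ∀ t, MeasurableSet[ℱ t] (goodSince A T t) := fun t =>
    MeasurableSet.biInter (Set.to_countable _) fun τ hτ => ℱ.mono hτ.2 _ (hA τ)
  have hnonneg : ∀ t, 0 ≤ ∫ ω in goodSince A T t, driftWeight q (Z t ω) ∂μ := fun t =>
    integral_nonneg fun ω => driftWeight_nonneg hq hq1 _
  have hcontract : ∀ᶠ t in atTop, ∫ ω in goodSince A T (t + 1), driftWeight q (Z (t + 1) ω) ∂μ ≤
      (1 - (q / 2) ^ K) * ∫ ω in goodSince A T t, driftWeight q (Z t ω) ∂μ + |1 - p t| := by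
    filter_upwards [hdown, hstay, eventually_ge_atTop T] with t hdown hstay hTt
    have hsub : ∀ k, goodSince A T t ∩ Z t ⁻¹' {k} ⊆ A t := fun k ω hω =>
      Set.mem_iInter₂.1 hω.1 t ⟨hTt, le_rfl⟩
    have hmeas : ∀ k, MeasurableSet[ℱ t] (goodSince A T t ∩ Z t ⁻¹' {k}) := fun k =>
      (hB t).inter (hZ t (measurableSet_singleton k))
    calc ∫ ω in goodSince A T (t + 1), driftWeight q (Z (t + 1) ω) ∂μ
        ≤ ∫ ω in goodSince A T t, driftWeight q (Z (t + 1) ω) ∂μ :=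
          setIntegral_mono_set (integrable_driftWeight hq hq1 (hZ' _)).integrableOn
            (Eventually.of_forall fun ω => driftWeight_nonneg hq hq1 _)
            (Set.biInter_subset_biInter_left (Set.Icc_subset_Icc_right t.le_succ)).eventuallyLE
      _ ≤ _ := setIntegral_driftWeight_le hq hq1 (hZ' t) (hZ' (t + 1)) (hK t) (ℱ.le t _ (hB t))
          (fun k hk => (hdown _ (hsub k) (hmeas k) fun ω hω => hω.2.trans_ne hk).trans
            (measureReal_mono fun ω hω => ⟨hω.1, hω.2.trans_eq hω.1.2⟩))
          (hstay _ (hsub 0) (hmeas 0) fun ω hω => hω.2)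
  have hlim := tendsto_zero_of_contraction (by positivity)
    (pow_le_one₀ (by positivity) (by linarith)) hnonneg
    (by simpa using (hp.const_sub 1).abs) hcontract
  refine squeeze_zero (fun t => measureReal_nonneg) (fun t => ?_) (by simpa using hlim.const_mul 2)
  linarith [half_mul_measureReal_le_setIntegral_driftWeight hq hq1 (hZ' t)
    (ℱ.le t _ (hB t)) (μ := μ)]

end Drift

/-! ### Replies under accurate estimates -/

section Beliefs

variable {M N : ℕ} {G : Network M N}

variable (G) in
/-- The key by which CU `m`, in the state `s`, believes pair `n` to rank the CUs: the estimated
allocation of `m` itself, the beliefs of `m` about the offers of the others, then the priority. -/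
def believedMerit (s : State M N) (m : Fin M) (n : Fin N) (k : Fin M) : ℝ ×ₗ ℕ :=
  toLex (if k = m then G.alloc m (s.Rhat m n) else s.αhat m k n, G.prio n k)

variable (G) in
/-- Estimated utility of CU `m` when it is selected by pair `n`, net of the negotiation cost. -/
def estimatedUtility (s : State M N) (m : Fin M) (n : Fin N) : ℝ :=
  (1 - G.alloc m (s.Rhat m n)) * s.Rhat m n - G.RC₀ m - G.θ

variable (G) in
/-- The estimates in the state `s` are good enough to recognize the acceptable pairs, and to rank
them and their acceptable suitors correctly. -/
structure Accurate (s : State M N) : Prop where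
  neg : ∀ m n, ¬ 0 < G.UCstar m n → estimatedUtility G s m n < 0
  pos : ∀ m n, 0 < G.UCstar m n → 0 < estimatedUtility G s m n
  lt : ∀ m n n', G.UCstar m n < G.UCstar m n' →
    estimatedUtility G s m n < estimatedUtility G s m n'
  merit : ∀ m k n, 0 < G.UCstar m n → 0 < G.UCstar k n →
    (believedMerit G s m n k ≤ believedMerit G s m n m ↔ G.merit n k ≤ G.merit n m)

theorem Accurate.wins_iff {s : State M N} (hs : Accurate G s) {b : Profile M N}
    (hb : ∀ k, Market.Acceptable G.UCstar k (b k)) {m : Fin M} {n : Fin N}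
    (hmn : 0 < G.UCstar m n) :
    Market.Wins (believedMerit G s m) b m n ↔ Market.Wins G.merit b m n :=
  forall₃_congr fun k _ hk => hs.merit m k n hmn (hb k n hk)

theorem eq_of_value_eq (hties : G.NoTies) {b : Profile M N} {m : Fin M}
    {x y : Option (Fin N)} (hx : 0 ≤ Market.value G.UCstar G.merit b m x)
    (hxy : Market.value G.UCstar G.merit b m x = Market.value G.UCstar G.merit b m y) :
    x = y := by
  rcases x with _ | n <;> rcases y with _ | n'
  · rfl
  · have hn' := Market.value_some_nonneg_iff.1 (hx.trans_eq hxy)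
    exact absurd (hxy.trans (Market.value_some_of_achieves hn')) hn'.1.ne
  · have hn := Market.value_some_nonneg_iff.1 hx
    exact absurd (hxy.symm.trans (Market.value_some_of_achieves hn)) hn.1.ne
  · have hn := Market.value_some_nonneg_iff.1 hx
    have hn' := Market.value_some_nonneg_iff.1 (hx.trans_eq hxy)
    rw [Market.value_some_of_achieves hn, Market.value_some_of_achieves hn'] at hxy
    by_contra hne
    exact hties.cu m n n' (fun h => hne (congrArg some h)) hn.1 hn'.1 hxy

variable {P : Params M N} {d : ℕ → Fin M → Decision N} {g : ℕ → Gains M N} {t : ℕ}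

theorem πhat_update_none (b : Profile M N) (m : Fin M) :
    πhat G P d g t m (Function.update b m none) = 0 := by
  simp [πhat]

open scoped Classical in
theorem πhat_update_some (ht : 2 ≤ t) (b : Profile M N) (m : Fin M) (n : Fin N) :
    πhat G P d g t m (Function.update b m (some n)) =
      if Market.Wins (believedMerit G (stateAt G P d g t) m) b m n then
        estimatedUtility G (stateAt G P d g t) m n else -G.θ := by
  have ht' : ¬ t ≤ 1 := by omega
  simp only [πhat, Function.update_self, if_neg ht', Network.choice_eq_some_iff]
  refine if_congr ?_ rfl rfl
  rw [Network.selects_iff_wins (κ := believedMerit G (stateAt G P d g t) m) fun k hk => by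
    simp only [hk]; rfl]
  rw [Function.update_self, eq_self_iff_true, true_and]
  exact forall₂_congr fun k hk => by rw [Function.update_of_ne hk]

section Accurate

variable (hG : G.Standing) (ht : 2 ≤ t) (hs : Accurate G (stateAt G P d g t)) {b : Profile M N}
include hG ht hs

theorem πhat_neg_of_not_acceptable {m : Fin M} {x : Option (Fin N)}
    (hx : ¬ Market.Acceptable G.UCstar m x) :
    πhat G P d g t m (Function.update b m x) < 0 := by
  obtain ⟨n, rfl, hn⟩ : ∃ n, x = some n ∧ ¬ 0 < G.UCstar m n := by
    simpa [Market.Acceptable] using hx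
  rw [πhat_update_some ht]
  split_ifs
  · exact hs.neg m n hn
  · exact neg_neg_of_pos hG.θ_pos

variable (hb : ∀ k, Market.Acceptable G.UCstar k (b k))
include hb

omit hG in
theorem πhat_eq_of_achieves {m : Fin M} {n : Fin N} (h : Market.Achieves G.UCstar G.merit b m n) :
    πhat G P d g t m (Function.update b m (some n)) =
      estimatedUtility G (stateAt G P d g t) m n := by
  rw [πhat_update_some ht, if_pos ((hs.wins_iff hb h.1).2 h.2)]

theorem πhat_neg_of_not_achieves {m : Fin M} {n : Fin N}
    (h : ¬ Market.Achieves G.UCstar G.merit b m n) :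
    πhat G P d g t m (Function.update b m (some n)) < 0 := by
  by_cases hpos : 0 < G.UCstar m n
  · rw [πhat_update_some ht, if_neg fun hw => h ⟨hpos, (hs.wins_iff hb hpos).1 hw⟩]
    exact neg_neg_of_pos hG.θ_pos
  · exact πhat_neg_of_not_acceptable hG ht hs fun hacc => hpos (hacc n rfl)

theorem πhat_lt_of_value_lt {m : Fin M} {x y : Option (Fin N)}
    (h : Market.value G.UCstar G.merit b m x < Market.value G.UCstar G.merit b m y) :
    πhat G P d g t m (Function.update b m x) < πhat G P d g t m (Function.update b m y) := by
  have hachieves : 0 ≤ Market.value G.UCstar G.merit b m x →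
      ∃ n, y = some n ∧ Market.Achieves G.UCstar G.merit b m n := fun hx =>
    Market.exists_achieves_of_value_pos (hx.trans_lt h)
  rcases x with _ | n
  · obtain ⟨n', rfl, hn'⟩ := hachieves le_rfl
    rw [πhat_update_none, πhat_eq_of_achieves ht hs hb hn']
    exact hs.pos m n' hn'.1
  by_cases hn : Market.Achieves G.UCstar G.merit b m n
  · obtain ⟨n', rfl, hn'⟩ := hachieves (Market.value_some_nonneg_iff.2 hn)
    rw [Market.value_some_of_achieves hn, Market.value_some_of_achieves hn'] at h
    rw [πhat_eq_of_achieves ht hs hb hn, πhat_eq_of_achieves ht hs hb hn']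
    exact hs.lt m n n' h
  · refine (πhat_neg_of_not_achieves hG ht hs hb hn).trans_le ?_
    rcases y with _ | n'
    · rw [πhat_update_none]
    · have hn' : Market.Achieves G.UCstar G.merit b m n' := by
        by_contra hn'
        simp [Market.value_some_of_not_achieves, hn, hn'] at h
      rw [πhat_eq_of_achieves ht hs hb hn']
      exact (hs.pos m n' hn'.1).le

omit hb in
theorem πhat_le_of_isEquilibrium (hties : G.NoTies)
    (hb : Market.IsEquilibrium G.UCstar G.merit b) (m : Fin M) (x : Option (Fin N)) :
    πhat G P d g t m (Function.update b m x) ≤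
      πhat G P d g t m (Function.update b m (b m)) := by
  rcases (hb m x).lt_or_eq with h | h
  · exact (πhat_lt_of_value_lt hG ht hs hb.isSettled.acceptable h).le
  · rw [eq_of_value_eq hties (hb m none) h.symm]

end Accurate

variable (P d) in
/-- Number of periods, up to `t` and capped at the memory length, for which the selections have
been those of period `t`. -/
def steadiness : ℕ → ℕ
  | 0 => 1
  | t + 1 => open scoped Classical in
    if selection P d (t + 1) = selection P d t then min P.L (steadiness t + 1) else 1

theorem steadiness_le (hP : P.Valid) : ∀ t, steadiness P d t ≤ P.L
  | 0 => hP.L_pos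
  | t + 1 => by
    rw [steadiness]
    split_ifs
    · exact min_le_left _ _
    · exact hP.L_pos

theorem selection_eq_of_lt_steadiness {τ : ℕ} (hτ : τ ≤ t) (h : t - τ < steadiness P d t) :
    selection P d τ = selection P d t := by
  induction t with
  | zero => rw [Nat.le_zero.1 hτ]
  | succ t ih =>
    rcases hτ.eq_or_lt with rfl | hlt
    · rfl
    rw [steadiness] at h
    split_ifs at h with heq
    · rw [heq]
      exact ih (by omega) (by have := min_le_right P.L (steadiness P d t + 1); omega)
    · omega

section Steady

variable (hP : P.Valid) (ht : 2 ≤ t) (hsteady : steadiness P d t = P.L)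
include hP ht hsteady

theorem mem_betterReplies_iff (m : Fin M) (x : Option (Fin N)) :
    x ∈ betterReplies G P d g (t + 1) m ↔
      πhat G P d g t m (Function.update (selection P d t) m (selection P d t m)) <
        πhat G P d g t m (Function.update (selection P d t) m x) := by
  have hL := hP.L_pos
  have hmemory : ∀ x, memoryValue G P d g (t + 1) m x =
      ((Finset.Ico (max 1 (t + 1 - P.L)) (t + 1)).card : ℝ) *
        πhat G P d g t m (Function.update (selection P d t) m x) := by
    intro x
    rw [← nsmul_eq_mul, ← Finset.sum_const, memoryValue]
    refine Finset.sum_congr rfl fun τ hτ => ?_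
    rw [Finset.mem_Ico, max_le_iff] at hτ
    rw [selection_eq_of_lt_steadiness (t := t) (by omega) (by omega)]
    rfl
  have hcard : (0 : ℝ) < (Finset.Ico (max 1 (t + 1 - P.L)) (t + 1)).card := by
    rw [Nat.cast_pos, Finset.card_pos, Finset.nonempty_Ico, max_lt_iff]
    omega
  simp only [betterReplies, Finset.mem_filter, Finset.mem_univ, true_and, hmemory,
    Nat.add_sub_cancel]
  exact mul_lt_mul_iff_right₀ hcard

variable (hG : G.Standing) (hs : Accurate G (stateAt G P d g t))
include hG hs

theorem exists_mem_betterReplies_of_step {b : Profile M N}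
    (h : Market.Step G.UCstar G.merit (selection P d t) b) :
    ∃ m x, b = Function.update (selection P d t) m x ∧
      x ∈ betterReplies G P d g (t + 1) m := by
  obtain ⟨m, x, rfl, h⟩ := h
  refine ⟨m, x, rfl, (mem_betterReplies_iff hP ht hsteady m x).2 ?_⟩
  rcases h with ⟨hunacc, rfl⟩ | ⟨hacc, hlt⟩
  · rw [πhat_update_none]
    exact πhat_neg_of_not_acceptable hG ht hs hunacc
  · exact πhat_lt_of_value_lt hG ht hs hacc hlt

theorem betterReplies_eq_empty (hties : G.NoTies)
    (h : Market.IsEquilibrium G.UCstar G.merit (selection P d t)) (m : Fin M) :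
    betterReplies G P d g (t + 1) m = ∅ :=
  Finset.eq_empty_of_forall_notMem fun x hx =>
    (πhat_le_of_isEquilibrium hG ht hs hties h m x).not_gt
      ((mem_betterReplies_iff hP ht hsteady m x).1 hx)

end Steady

end Beliefs

/-! ### Estimates along a path -/

section Limits

variable {ι : Type*} {l : Filter ι}

theorem tendsto_add_div_add {K S : ι → ℝ} {r : ℝ} (a c : ℝ) (hK : Tendsto K l atTop)
    (hS : Tendsto (fun t => (K t)⁻¹ * S t) l (𝓝 r)) :
    Tendsto (fun t => (a + S t) / (c + K t)) l (𝓝 r) := by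
  have hquot := ((hK.const_div_atTop a).add hS).div ((hK.const_div_atTop c).add_const 1) (by simp)
  rw [zero_add, zero_add, div_one] at hquot
  refine hquot.congr' ?_
  filter_upwards [hK.eventually_gt_atTop 0] with t ht
  simp only [Pi.div_apply]
  field_simp

theorem eventually_toLex_le_toLex_iff {α β : Type*} [LinearOrder α] [TopologicalSpace α]
    [OrderClosedTopology α] [LinearOrder β] {x y : ι → α} {a b : α} (p q : β)
    (hx : Tendsto x l (𝓝 a)) (hy : Tendsto y l (𝓝 b)) (hxy : a = b → x =ᶠ[l] y) :
    ∀ᶠ t in l, toLex (x t, p) ≤ toLex (y t, q) ↔ toLex (a, p) ≤ toLex (b, q) := by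
  simp only [Prod.Lex.toLex_le_toLex]
  rcases lt_trichotomy a b with h | h | h
  · filter_upwards [hx.eventually_lt hy h] with t ht
    simp [ht, h]
  · filter_upwards [hxy h] with t ht
    simp [ht, h]
  · filter_upwards [hy.eventually_lt hx h] with t ht
    simp [ht.not_gt, ht.ne', h.not_gt, h.ne']

theorem tendsto_of_frequently_updated {α : Type*} {x y : ℕ → α} {l : Filter α}
    (hy : Tendsto y atTop l) (hx : ∀ t, x (t + 1) = y t ∨ x (t + 1) = x t)
    (hfreq : ∃ᶠ t in atTop, x (t + 1) = y t) : Tendsto x atTop l := by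
  intro S hS
  obtain ⟨T, hT⟩ := eventually_atTop.1 (hy hS)
  obtain ⟨t₀, ht₀, hupdate⟩ := frequently_atTop.1 hfreq T
  refine eventually_atTop.2 ⟨t₀ + 1, fun t ht => ?_⟩
  induction t, ht using Nat.le_induction with
  | base => exact hupdate ▸ hT t₀ ht₀
  | succ t ht ih =>
    rcases hx t with h | h
    · exact h ▸ hT t (by omega)
    · exact h ▸ ih

end Limits

section Path

variable {M N : ℕ} {G : Network M N}

variable (G) in
/-- Pair `n` selects CU `m` in the period with decisions `d` following the state `s`. -/
def Selected (s : State M N) (d : Fin M → Decision N) (m : Fin M) (n : Fin N) : Prop :=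
  G.Selects (fun k => (d k).1) (offer G s d) n m

theorem alloc_lt_αe (hG : G.Standing) (m : Fin M) (R : ℝ) : G.alloc m R < G.αe :=
  (max_le hG.αL_le_αU (min_le_right _ _)).trans_lt (lt_add_of_pos_right _ hG.θ'_pos)

/-- The decisions by which everybody proposes to `n`, and `m` alone offers `α_e`. -/
def boldDecision (m : Fin M) (n : Fin N) (k : Fin M) : Decision N := (some n, decide (k = m))

theorem selected_boldDecision (hG : G.Standing) (s : State M N) (m : Fin M) (n : Fin N) :
    Selected G s (boldDecision m n) m n := by
  refine ⟨rfl, fun k _ => ?_⟩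
  rcases eq_or_ne k m with rfl | hk
  · exact Or.inr ⟨rfl, le_rfl⟩
  · refine Or.inl ?_
    simp only [offer, boldDecision, hk, decide_false, decide_true, if_true]
    exact alloc_lt_αe hG _ _

section Step

variable (s : State M N) (d : Fin M → Decision N) (g : Gains M N)

open scoped Classical in
theorem count_step (m : Fin M) (n : Fin N) :
    (step G s d g).count m n = s.count m n + if Selected G s d m n then 1 else 0 := by
  simp only [step, Network.choice_eq_some_iff]
  rfl

open scoped Classical in
theorem one_add_count_mul_Rhat_step (m : Fin M) (n : Fin N) :
    (1 + ((step G s d g).count m n : ℝ)) * (step G s d g).Rhat m n =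
      (1 + (s.count m n : ℝ)) * s.Rhat m n +
        if Selected G s d m n then G.relayRate g m n else 0 := by
  have hchoice : G.choice (fun k => (d k).1) (offer G s d) n = some m ↔ Selected G s d m n :=
    G.choice_eq_some_iff _ _ _ _
  rw [count_step]
  by_cases h : Selected G s d m n
  · simp only [step, if_pos h, if_pos (hchoice.2 h)]
    push_cast
    field_simp
    ring
  · simp only [step, if_neg h, if_neg (mt hchoice.1 h)]
    push_cast
    ring

open scoped Classical in
theorem αhat_step (hG : G.Standing) (m k : Fin M) (n : Fin N) :
    (step G s d g).αhat m k n =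
      if d k = (some n, false) then G.alloc k (s.Rhat k n) else s.αhat m k n := by
  rcases hk : d k with ⟨x, _ | _⟩
  · rcases x with _ | n'
    · simp [step, hk]
    · rcases eq_or_ne n' n with rfl | hne
      · simp [step, offer, hk, (alloc_lt_αe hG _ _).ne]
      · simp [step, hk, hne]
  · simp [step, offer, hk]

end Step

variable {P : Params M N} {d : ℕ → Fin M → Decision N} {g : ℕ → Gains M N}

open scoped Classical in
theorem count_stateAt (m : Fin M) (n : Fin N) (t : ℕ) :
    (stateAt G P d g (t + 1)).count m n = (initState G P).count m n +
      Nat.count (fun τ => Selected G (stateAt G P d g (τ + 1)) (d (τ + 2)) m n) t := by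
  induction t with
  | zero => simp [stateAt]
  | succ t ih => rw [Nat.count_succ, ← add_assoc, ← ih, stateAt, count_step]

open scoped Classical in
theorem one_add_count_mul_Rhat_stateAt (m : Fin M) (n : Fin N) (t : ℕ) :
    (1 + ((stateAt G P d g (t + 1)).count m n : ℝ)) * (stateAt G P d g (t + 1)).Rhat m n =
      (1 + ((initState G P).count m n : ℝ)) * P.Rhat1 m n + ∑ τ ∈ Finset.range t,
        if Selected G (stateAt G P d g (τ + 1)) (d (τ + 2)) m n
          then G.relayRate (g (τ + 2)) m n else 0 := by
  induction t with
  | zero => simp [stateAt, initState]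
  | succ t ih =>
    rw [Finset.sum_range_succ, ← add_assoc, ← ih, stateAt, one_add_count_mul_Rhat_step]

open scoped Classical in
theorem tendsto_Rhat {m : Fin M} {n : Fin N} {r : ℝ}
    (hinf : {t | Selected G (stateAt G P d g (t + 1)) (d (t + 2)) m n}.Infinite)
    (hlim : Tendsto (fun t =>
      (Nat.count (fun τ => Selected G (stateAt G P d g (τ + 1)) (d (τ + 2)) m n) t : ℝ)⁻¹ *
        ∑ τ ∈ Finset.range t, if Selected G (stateAt G P d g (τ + 1)) (d (τ + 2)) m n
          then G.relayRate (g (τ + 2)) m n else 0) atTop (𝓝 r)) :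
    Tendsto (fun t => (stateAt G P d g t).Rhat m n) atTop (𝓝 r) := by
  rw [← tendsto_add_atTop_iff_nat 1]
  refine (tendsto_add_div_add ((1 + ((initState G P).count m n : ℝ)) * P.Rhat1 m n)
    (1 + ((initState G P).count m n : ℝ))
    (tendsto_natCast_atTop_atTop.comp (tendsto_count_atTop hinf)) hlim).congr fun t => ?_
  rw [Function.comp_apply, div_eq_iff (by positivity), ← one_add_count_mul_Rhat_stateAt,
    count_stateAt]
  push_cast
  ring

theorem tendsto_αhat (hG : G.Standing) {k : Fin M} {n : Fin N} {l : Filter ℝ} (m : Fin M)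
    (hα : Tendsto (fun t => alphaAt G P d g t k n) atTop l)
    (hd : ∃ᶠ t in atTop, d t = fun _ => (some n, false)) :
    Tendsto (fun t => (stateAt G P d g t).αhat m k n) atTop l := by
  classical
  rw [← tendsto_add_atTop_iff_nat 1] at hα ⊢
  have hstep : ∀ t, (stateAt G P d g (t + 2)).αhat m k n =
      if d (t + 2) k = (some n, false) then alphaAt G P d g (t + 1) k n
        else (stateAt G P d g (t + 1)).αhat m k n := fun t => αhat_step _ _ _ hG m k n
  refine tendsto_of_frequently_updated hα (fun t => ?_) ?_
  · rw [hstep]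
    exact ite_eq_or_eq _ _ _
  · refine frequently_atTop.2 fun T => ?_
    obtain ⟨t, ht, hdt⟩ := frequently_atTop.1 hd (T + 2)
    obtain ⟨τ, rfl⟩ := Nat.exists_eq_add_of_le' (show 2 ≤ t by omega)
    exact ⟨τ, by omega, by rw [hstep, hdt, if_pos rfl]⟩

section Alloc

variable {m : Fin M} {R : ℝ} (hR : R ≠ 0)
include hR

theorem continuousAt_rawAlloc : ContinuousAt (G.rawAlloc m) R := by
  unfold Network.rawAlloc
  have : 2 * R ≠ 0 := mul_ne_zero two_ne_zero hR
  fun_prop (disch := assumption)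

theorem continuousAt_alloc : ContinuousAt (G.alloc m) R := by
  have := continuousAt_rawAlloc (G := G) (m := m) hR
  unfold Network.alloc
  fun_prop

theorem eventually_alloc_eq_αU (hG : G.Standing) (h : G.αU < G.rawAlloc m R) :
    ∀ᶠ R' in 𝓝 R, G.alloc m R' = G.αU := by
  filter_upwards [(continuousAt_rawAlloc hR).eventually_const_lt h] with R' h'
  rw [Network.alloc, min_eq_right h'.le, max_eq_right hG.αL_le_αU]

theorem eventually_alloc_eq_αL (h : G.rawAlloc m R < G.αL) :
    ∀ᶠ R' in 𝓝 R, G.alloc m R' = G.αL := by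
  filter_upwards [(continuousAt_rawAlloc hR).eventually_lt_const h] with R' h'
  rw [Network.alloc, max_eq_left ((min_le_left _ _).trans h'.le)]

end Alloc

section Convergence

variable (hG : G.Standing)
  (hR : ∀ m n, Tendsto (fun t => (stateAt G P d g t).Rhat m n) atTop (𝓝 (G.RC m n)))
include hG hR

theorem tendsto_alphaAt (m : Fin M) (n : Fin N) :
    Tendsto (fun t => alphaAt G P d g t m n) atTop (𝓝 (G.alphaStar m n)) :=
  (continuousAt_alloc (hG.RC_pos m n).ne').tendsto.comp (hR m n)

theorem tendsto_estimatedUtility (m : Fin M) (n : Fin N) :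
    Tendsto (fun t => estimatedUtility G (stateAt G P d g t) m n) atTop
      (𝓝 (G.UCstar m n - G.θ)) :=
  (((tendsto_const_nhds.sub (tendsto_alphaAt hG hR m n)).mul (hR m n)).sub_const _).sub_const _

variable (hties : G.NoTies) (hd : ∀ n, ∃ᶠ t in atTop, d t = fun _ => (some n, false))
include hties hd

theorem eventually_αhat_eq_alphaAt {m k : Fin M} {n : Fin N} (hmk : m ≠ k)
    (hm : 0 < G.UCstar m n) (hk : 0 < G.UCstar k n)
    (heq : G.alphaStar k n = G.alphaStar m n) :
    ∀ᶠ t in atTop, (stateAt G P d g t).αhat m k n = alphaAt G P d g t m n := by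
  obtain ⟨c, hcm, hck⟩ : ∃ c, (∀ᶠ t in atTop, alphaAt G P d g t m n = c) ∧
      ∀ᶠ t in atTop, alphaAt G P d g t k n = c := by
    have hRm := (hG.RC_pos m n).ne'
    have hRk := (hG.RC_pos k n).ne'
    rcases hties.d2d n m k hmk hm hk heq.symm with ⟨hcut, hcut'⟩ | ⟨hcut, hcut'⟩
    · exact ⟨G.αU, (hR m n).eventually (eventually_alloc_eq_αU hRm hG hcut),
        (hR k n).eventually (eventually_alloc_eq_αU hRk hG hcut')⟩
    · exact ⟨G.αL, (hR m n).eventually (eventually_alloc_eq_αL hRm hcut),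
        (hR k n).eventually (eventually_alloc_eq_αL hRk hcut')⟩
  filter_upwards [hcm, tendsto_pure.1 (tendsto_αhat hG m (tendsto_pure.2 hck) (hd n))]
    with t htm htk
  rw [htm, htk]

theorem eventually_believedMerit_le_iff {m k : Fin M} {n : Fin N} (hm : 0 < G.UCstar m n)
    (hk : 0 < G.UCstar k n) :
    ∀ᶠ t in atTop, believedMerit G (stateAt G P d g t) m n k ≤
      believedMerit G (stateAt G P d g t) m n m ↔ G.merit n k ≤ G.merit n m := by
  rcases eq_or_ne k m with rfl | hne
  · simp
  simp only [believedMerit, if_neg hne, if_true]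
  exact eventually_toLex_le_toLex_iff _ _ (tendsto_αhat hG m (tendsto_alphaAt hG hR k n) (hd n))
    (tendsto_alphaAt hG hR m n) (eventually_αhat_eq_alphaAt hG hR hties hd hne.symm hm hk)

theorem eventually_accurate : ∀ᶠ t in atTop, Accurate G (stateAt G P d g t) := by
  have hu := tendsto_estimatedUtility hG hR
  have hθ := hG.θ_pos
  have hneg : ∀ m n, ∀ᶠ t in atTop, ¬ 0 < G.UCstar m n →
      estimatedUtility G (stateAt G P d g t) m n < 0 := fun m n =>
    eventually_imp_distrib_left.2 fun h => (hu m n).eventually_lt_const (by linarith)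
  have hpos : ∀ m n, ∀ᶠ t in atTop, 0 < G.UCstar m n →
      0 < estimatedUtility G (stateAt G P d g t) m n := fun m n =>
    eventually_imp_distrib_left.2 fun h =>
      (hu m n).eventually_const_lt (sub_pos.2 (hG.θ_small m n h))
  have hlt : ∀ m n n', ∀ᶠ t in atTop, G.UCstar m n < G.UCstar m n' →
      estimatedUtility G (stateAt G P d g t) m n <
        estimatedUtility G (stateAt G P d g t) m n' := fun m n n' =>
    eventually_imp_distrib_left.2 fun h => (hu m n).eventually_lt (hu m n') (by linarith)
  have hmerit : ∀ m k n, ∀ᶠ t in atTop, 0 < G.UCstar m n → 0 < G.UCstar k n →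
      (believedMerit G (stateAt G P d g t) m n k ≤ believedMerit G (stateAt G P d g t) m n m ↔
        G.merit n k ≤ G.merit n m) := fun m k n =>
    eventually_imp_distrib_left.2 fun hm => eventually_imp_distrib_left.2 fun hk =>
      eventually_believedMerit_le_iff hG hR hties hd hm hk
  simp only [← eventually_all] at hneg hpos hlt hmerit
  filter_upwards [hneg, hpos, hlt, hmerit] with t h₁ h₂ h₃ h₄
  exact ⟨h₁, h₂, h₃, h₄⟩

end Convergence

end Path

/-! ### Decision probabilities -/

section Probabilities

variable {M N : ℕ} {P : Params M N}

theorem tendsto_sum_atTop_of_div_le {u : ℕ → ℝ} {c : ℝ} (hc : 0 < c)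
    (hu : ∀ k : ℕ, c / (k + 1) ≤ u k) :
    Tendsto (fun n => ∑ k ∈ Finset.range n, u k) atTop atTop := by
  refine tendsto_atTop_mono (fun n => ?_)
    (Real.tendsto_sum_range_one_div_nat_succ_atTop.const_mul_atTop hc)
  rw [Finset.mul_sum]
  exact Finset.sum_le_sum fun k _ => (mul_one_div c _).trans_le (hu k)

section ExplorationRate

variable (hP : P.Valid)
include hP

theorem Params.Valid.ε_nonneg (t : ℕ) : 0 ≤ P.ε t :=
  mul_nonneg hP.ε₀_pos.le (Real.rpow_nonneg (Nat.cast_nonneg t) _)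

theorem Params.Valid.ε_le_one {t : ℕ} (ht : 1 ≤ t) : P.ε t ≤ 1 := by
  refine mul_le_one₀ hP.ε₀_le (Real.rpow_nonneg (Nat.cast_nonneg t) _) ?_
  refine Real.rpow_le_one_of_one_le_of_nonpos (by exact_mod_cast ht) ?_
  exact div_nonpos_of_nonpos_of_nonneg (by norm_num) (by positivity)

theorem Params.Valid.one_sub_ε_nonneg {t : ℕ} (ht : 1 ≤ t) : 0 ≤ 1 - P.ε t :=
  sub_nonneg.2 (hP.ε_le_one ht)

theorem Params.Valid.tendsto_ε (hM : M ≠ 0) : Tendsto P.ε atTop (𝓝 0) := by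
  have hML : 0 < (M : ℝ) * P.L :=
    mul_pos (Nat.cast_pos.2 (Nat.pos_of_ne_zero hM)) (Nat.cast_pos.2 hP.L_pos)
  have h := ((tendsto_rpow_neg_atTop (one_div_pos.2 hML)).comp
    (tendsto_natCast_atTop_atTop (R := ℝ))).const_mul P.ε₀
  change Tendsto (fun t => P.ε t) atTop (𝓝 0)
  simpa only [Function.comp_def, Params.ε, neg_div, mul_zero] using h

theorem Params.Valid.tendsto_one_sub_ε_pow :
    Tendsto (fun t => (1 - P.ε t) ^ M) atTop (𝓝 1) := by
  rcases eq_or_ne M 0 with rfl | hM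
  · simp
  · simpa using ((hP.tendsto_ε hM).const_sub 1).pow M

theorem Params.Valid.div_le_ε_pow {t : ℕ} (ht : 1 ≤ t) :
    P.ε₀ ^ M / t ≤ P.ε t ^ M := by
  have hexp : -1 ≤ -1 / ((M : ℝ) * P.L) * M := by
    have hle : (M : ℝ) / (M * P.L) ≤ 1 := div_le_one_of_le₀
      (le_mul_of_one_le_right (Nat.cast_nonneg M) (by exact_mod_cast hP.L_pos)) (by positivity)
    rw [div_mul_eq_mul_div, neg_one_mul, neg_div]
    exact neg_le_neg hle
  rw [Params.ε, mul_pow, ← Real.rpow_mul_natCast (Nat.cast_nonneg t), div_eq_mul_inv,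
    ← Real.rpow_neg_one]
  exact mul_le_mul_of_nonneg_left
    (Real.rpow_le_rpow_of_exponent_le (by exact_mod_cast ht) hexp) (pow_nonneg hP.ε₀_pos.le _)

end ExplorationRate

variable {G : Network M N} {d : ℕ → Fin M → Decision N} {g : ℕ → Gains M N} {t : ℕ}

theorem replyProb_nonneg (m : Fin M) (x : Option (Fin N)) : 0 ≤ replyProb G P d g t m x := by
  unfold replyProb
  split_ifs
  · exact ENNReal.toReal_nonneg
  · exact zero_le_one
  · exact le_rfl

theorem exploitProb_eq_one (m : Fin M) (h : betterReplies G P d g t m = ∅) :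
    exploitProb G P d g t m (selection P d (t - 1) m, false) = 1 := by
  simp [exploitProb, replyProb, h]

section Valid

variable (hP : P.Valid)
include hP

theorem exploreProb_nonneg (y : Decision N) : 0 ≤ exploreProb P y := by
  have hN : 0 ≤ 1 / (N : ℝ) := by positivity
  rcases y with ⟨_ | n, _ | _⟩
  · exact le_rfl
  · exact le_rfl
  · exact mul_nonneg hN hP.ζ_pos.le
  · exact mul_nonneg hN (sub_nonneg.2 hP.ζ_lt.le)

theorem exploreProb_pos {y : Decision N} (hy : y.1 ≠ none) : 0 < exploreProb P y := by
  obtain ⟨_ | n, e⟩ := y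
  · exact absurd rfl hy
  have hN : 0 < 1 / (N : ℝ) := one_div_pos.2 (Nat.cast_pos.2 n.pos)
  cases e
  · exact mul_pos hN hP.ζ_pos
  · exact mul_pos hN (sub_pos.2 hP.ζ_lt)

theorem ξ_le_exploitProb (m : Fin M) :
    P.ξ ≤ exploitProb G P d g t m (selection P d (t - 1) m, false) := by
  simp only [exploitProb, if_true, mul_one]
  exact le_add_of_nonneg_right (mul_nonneg (sub_nonneg.2 hP.ξ_lt.le) (replyProb_nonneg m _))

theorem replyProb_le_exploitProb (m : Fin M) (x : Option (Fin N)) :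
    (1 - P.ξ) * replyProb G P d g t m x ≤ exploitProb G P d g t m (x, false) :=
  le_add_of_nonneg_left (mul_nonneg hP.ξ_pos.le (by split_ifs <;> simp))

theorem exploitProb_nonneg (m : Fin M) (y : Decision N) : 0 ≤ exploitProb G P d g t m y := by
  rcases y with ⟨x, _ | _⟩
  · exact (mul_nonneg (sub_nonneg.2 hP.ξ_lt.le) (replyProb_nonneg m x)).trans
      (replyProb_le_exploitProb hP m x)
  · exact le_rfl

theorem exists_pos_le_exploitProb (G : Network M N) :
    ∃ p, 0 < p ∧ p ≤ 1 ∧ ∀ d g t m x,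
      x = selection P d (t - 1) m ∨ x ∈ betterReplies G P d g t m →
        p ≤ exploitProb G P d g t m (x, false) := by
  have hreply : ∀ m S x, x ∈ S → 0 < (P.reply m S x).toReal := fun m S x hx =>
    ENNReal.toReal_pos ((PMF.mem_support_iff _ _).1 (hP.reply_support m S ⟨x, hx⟩ ▸ hx))
      (PMF.apply_ne_top _ _)
  have hsmall : ∀ᶠ c in 𝓝[>] (0 : ℝ), ∀ m S x, x ∈ S → c ≤ (P.reply m S x).toReal := by
    simp only [eventually_all]
    intro m S x hx
    filter_upwards [Ioc_mem_nhdsGT (hreply m S x hx)] with c hc using hc.2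
  obtain ⟨c, hc, hcpos⟩ := (hsmall.and self_mem_nhdsWithin).exists
  have hξ : 0 < 1 - P.ξ := sub_pos.2 hP.ξ_lt
  refine ⟨min P.ξ ((1 - P.ξ) * c), lt_min hP.ξ_pos (mul_pos hξ hcpos),
    (min_le_left _ _).trans hP.ξ_lt.le, ?_⟩
  rintro d g t m x (rfl | hx)
  · exact (min_le_left _ _).trans (ξ_le_exploitProb hP m)
  · refine (min_le_right _ _).trans (le_trans ?_ (replyProb_le_exploitProb hP m x))
    rw [replyProb, if_pos ⟨x, hx⟩]
    exact mul_le_mul_of_nonneg_left (hc m _ x hx) hξ.le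

theorem explore_le_prod_decisionProb (ht : 1 ≤ t) (y : Fin M → Decision N) :
    P.ε t ^ M * ∏ m, exploreProb P (y m) ≤ ∏ m, decisionProb G P d g t m (y m) := by
  have h := Finset.prod_le_prod (s := Finset.univ) (f := fun m => P.ε t * exploreProb P (y m))
    (g := fun m => decisionProb G P d g t m (y m))
    (fun m _ => mul_nonneg (hP.ε_nonneg t) (exploreProb_nonneg hP _))
    fun m _ => le_add_of_nonneg_right
      (mul_nonneg (hP.one_sub_ε_nonneg ht) (exploitProb_nonneg hP m _))
  simpa [Finset.prod_mul_distrib] using h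

theorem exploit_le_prod_decisionProb (ht : 1 ≤ t) {y : Fin M → Decision N} {p : ℝ}
    (hp : 0 ≤ p) (hy : ∀ m, p ≤ exploitProb G P d g t m (y m)) :
    (1 - P.ε t) ^ M * p ^ M ≤ ∏ m, decisionProb G P d g t m (y m) := by
  have hε := hP.one_sub_ε_nonneg ht
  have h := Finset.prod_le_prod (s := Finset.univ) (f := fun _ : Fin M => (1 - P.ε t) * p)
    (g := fun m => decisionProb G P d g t m (y m)) (fun _ _ => mul_nonneg hε hp)
    fun m _ => (mul_le_mul_of_nonneg_left (hy m) hε).trans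
      (le_add_of_nonneg_left (mul_nonneg (hP.ε_nonneg t) (exploreProb_nonneg hP _)))
  simpa [mul_pow] using h

end Valid

end Probabilities

/-! ### Measurability -/

section Measurability

variable {M N : ℕ} {G : Network M N}

theorem measurable_apply_of_countable {Ω α β : Type*} {mΩ : MeasurableSpace Ω}
    [MeasurableSpace β] [Countable α] {f : Ω → α} (hf : Measurable[mΩ, ⊤] f) {F : α → Ω → β}
    (hF : ∀ y, Measurable (F y)) : Measurable fun ω => F (f ω) ω := by
  let : MeasurableSpace α := ⊤
  exact (measurable_from_prod_countable_right (f := fun p : α × Ω => F p.1 p.2) hF).comp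
    (hf.prodMk measurable_id)

/-- The product σ-algebra of the three tables of estimates. -/
instance : MeasurableSpace (State M N) :=
  MeasurableSpace.comap (fun s => (s.Rhat, s.count, s.αhat)) inferInstance

theorem measurable_tables :
    Measurable fun s : State M N => (s.Rhat, s.count, s.αhat) :=
  comap_measurable _

@[fun_prop]
theorem measurable_state_Rhat (m : Fin M) (n : Fin N) :
    Measurable fun s : State M N => s.Rhat m n :=
  measurable_pi_iff.1 (measurable_pi_iff.1 measurable_tables.fst m) n

@[fun_prop]
theorem measurable_state_count (m : Fin M) (n : Fin N) :
    Measurable fun s : State M N => s.count m n :=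
  measurable_pi_iff.1 (measurable_pi_iff.1 measurable_tables.snd.fst m) n

@[fun_prop]
theorem measurable_state_αhat (m k : Fin M) (n : Fin N) :
    Measurable fun s : State M N => s.αhat m k n :=
  measurable_pi_iff.1
    (measurable_pi_iff.1 (measurable_pi_iff.1 measurable_tables.snd.snd m) k) n

@[fun_prop]
theorem measurable_alloc (m : Fin M) : Measurable (G.alloc m) := by
  unfold Network.alloc Network.rawAlloc
  fun_prop

@[fun_prop]
theorem measurable_relayRate (m : Fin M) (n : Fin N) :
    Measurable fun g : Gains M N => G.relayRate g m n := by
  unfold Network.relayRate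
  fun_prop

@[fun_prop]
theorem measurable_offer (d : Fin M → Decision N) (m : Fin M) :
    Measurable fun s : State M N => offer G s d m := by
  unfold offer
  split_ifs
  · exact measurable_const
  · cases (d m).1 <;> fun_prop

theorem measurable_lex_le {Ω : Type*} [MeasurableSpace Ω] {f f' : Ω → ℝ}
    (hf : Measurable f) (hf' : Measurable f') (p p' : ℕ) :
    Measurable fun ω => f ω < f' ω ∨ f ω = f' ω ∧ p ≤ p' :=
  (measurableSet_setOfPred.1 (measurableSet_lt hf hf')).or
    ((measurableSet_setOfPred.1 (measurableSet_eq_fun hf hf')).and measurable_const)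

theorem measurable_selected (d : Fin M → Decision N) (m : Fin M) (n : Fin N) :
    Measurable fun s : State M N => Selected G s d m n :=
  measurable_const.and <| Measurable.forall fun k =>
    measurable_const.imp (measurable_lex_le (measurable_offer d k) (measurable_offer d m) _ _)

theorem measurable_step (d : Fin M → Decision N) :
    Measurable fun p : State M N × Gains M N => step G p.1 d p.2 := by
  classical
  have hselected (m : Fin M) (n : Fin N) : Measurable fun p : State M N × Gains M N =>
      if G.choice (fun k => (d k).1) (offer G p.1 d) n = some m then 1 else (0 : ℕ) := by
    simp only [Network.choice_eq_some_iff]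
    exact Measurable.ite ((measurable_selected d m n).comp measurable_fst).setOf
      measurable_const measurable_const
  have hcast : Measurable fun k : ℕ => (k : ℝ) := measurable_from_top
  rw [measurable_comap_iff]
  refine Measurable.prodMk ?_ (Measurable.prodMk ?_ ?_)
  · refine measurable_pi_iff.2 fun m => measurable_pi_iff.2 fun n => ?_
    have := hselected m n
    simp only [step]
    fun_prop
  · refine measurable_pi_iff.2 fun m => measurable_pi_iff.2 fun n => ?_
    have := hselected m n
    simp only [step]
    fun_prop
  · refine measurable_pi_iff.2 fun m => measurable_pi_iff.2 fun k => measurable_pi_iff.2 fun n => ?_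
    refine Measurable.ite ?_ (by fun_prop) (by fun_prop)
    exact (MeasurableSet.const _).inter
      (measurableSet_eq_fun (by fun_prop) measurable_const).compl

@[fun_prop]
theorem measurable_estimatedUtility (m : Fin M) (n : Fin N) :
    Measurable fun s : State M N => estimatedUtility G s m n := by
  unfold estimatedUtility
  fun_prop

theorem measurable_believedMerit_le (m k : Fin M) (n : Fin N) :
    Measurable fun s : State M N => believedMerit G s m n k ≤ believedMerit G s m n m := by
  have hown : Measurable fun s : State M N => G.alloc m (s.Rhat m n) := by fun_prop
  have hkey : Measurable fun s : State M N =>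
      if k = m then G.alloc m (s.Rhat m n) else s.αhat m k n := by
    split_ifs <;> fun_prop
  simp only [believedMerit, Prod.Lex.toLex_le_toLex, if_true]
  exact measurable_lex_le hkey hown _ _

theorem measurableSet_accurate : MeasurableSet {s : State M N | Accurate G s} := by
  have haccurate : ∀ s : State M N, Accurate G s ↔ _ ∧ _ ∧ _ ∧ _ := fun s =>
    ⟨fun h => ⟨h.neg, h.pos, h.lt, h.merit⟩, fun h => ⟨h.1, h.2.1, h.2.2.1, h.2.2.2⟩⟩
  simp only [haccurate]
  have hu := measurable_estimatedUtility (G := G)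
  refine measurableSet_setOfPred.2 (Measurable.and ?_ (Measurable.and ?_ (Measurable.and ?_ ?_)))
  · exact Measurable.forall fun m => Measurable.forall fun n => measurable_const.imp
      (measurableSet_setOfPred.1 (measurableSet_lt (hu m n) measurable_const))
  · exact Measurable.forall fun m => Measurable.forall fun n => measurable_const.imp
      (measurableSet_setOfPred.1 (measurableSet_lt measurable_const (hu m n)))
  · exact Measurable.forall fun m => Measurable.forall fun n => Measurable.forall fun n' =>
      measurable_const.imp (measurableSet_setOfPred.1 (measurableSet_lt (hu m n) (hu m n')))
  · exact Measurable.forall fun m => Measurable.forall fun k => Measurable.forall fun n =>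
      measurable_const.imp (measurable_const.imp
        ((measurable_believedMerit_le m k n).iff measurable_const))

end Measurability

/-! ### The approach to an equilibrium -/

section Approach

variable {M N : ℕ} {G : Network M N} {P : Params M N} {rank : Profile M N → ℕ}
  {next : Profile M N → Profile M N} {d : ℕ → Fin M → Decision N} {g : ℕ → Gains M N} {t : ℕ}

variable (G rank next) in
/-- `next` moves by single better replies, each decreasing `rank`, until it rests at an
equilibrium. -/
def LeadsToEquilibrium : Prop :=
  ∀ b, (rank b = 0 ∧ Market.IsEquilibrium G.UCstar G.merit b ∧ next b = b) ∨
    (Market.Step G.UCstar G.merit b (next b) ∧ rank (next b) < rank b)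

variable (P next d t) in
/-- Selections for period `t + 1` that approach an equilibrium: those of period `t` until all
remembered selections agree, so that better replies to the memory are better replies to the present
selections, and the move `next` after that. -/
def target : Profile M N :=
  if steadiness P d t < P.L then selection P d t else next (selection P d t)

variable (P rank d t) in
/-- The number of successive periods of following `target` that suffices, from period `t` on, to
have an equilibrium in the whole memory. -/
def potential : ℕ := P.L * rank (selection P d t) + (P.L - steadiness P d t)

theorem exists_leadsToEquilibrium (G : Network M N) :
    ∃ rank next, LeadsToEquilibrium G rank next :=
  exists_rank_and_next (Market.exists_isEquilibrium G.merit_injective)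

theorem LeadsToEquilibrium.of_rank_eq_zero (hnext : LeadsToEquilibrium G rank next)
    {b : Profile M N} (hb : rank b = 0) :
    Market.IsEquilibrium G.UCstar G.merit b ∧ next b = b :=
  (hnext b).elim And.right fun h => absurd (hb ▸ h.2) (Nat.not_lt_zero _)

theorem LeadsToEquilibrium.of_rank_ne_zero (hnext : LeadsToEquilibrium G rank next)
    {b : Profile M N} (hb : rank b ≠ 0) :
    Market.Step G.UCstar G.merit b (next b) ∧ rank (next b) < rank b :=
  (hnext b).resolve_left fun h => hb h.1

theorem selection_succ_of_eq {b : Profile M N} (ht : 1 ≤ t)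
    (h : d (t + 1) = fun m => (b m, false)) : selection P d (t + 1) = b := by
  simp only [selection, h, if_neg (show ¬ t + 1 ≤ 1 by omega)]

theorem potential_le : potential P rank d t ≤ P.L * ∑ b, rank b + P.L :=
  Nat.add_le_add (Nat.mul_le_mul_left _ (Finset.single_le_sum_of_canonicallyOrdered
    (Finset.mem_univ _))) (Nat.sub_le _ _)

variable (hP : P.Valid) (hnext : LeadsToEquilibrium G rank next)
include hP

theorem potential_eq_zero_iff :
    potential P rank d t = 0 ↔ rank (selection P d t) = 0 ∧ steadiness P d t = P.L := by
  have hle := steadiness_le (d := d) hP t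
  have hL := hP.L_pos
  rw [potential, Nat.add_eq_zero_iff, Nat.mul_eq_zero, Nat.sub_eq_zero_iff_le]
  omega

include hnext

theorem isEquilibrium_of_potential_eq_zero (h : potential P rank d t = 0) :
    Market.IsEquilibrium G.UCstar G.merit (selection P d t) :=
  (hnext.of_rank_eq_zero ((potential_eq_zero_iff hP).1 h).1).1

theorem target_eq_of_potential_eq_zero (h : potential P rank d t = 0) :
    target P next d t = selection P d t := by
  obtain ⟨hrank, hsteady⟩ := (potential_eq_zero_iff hP).1 h
  rw [target, if_neg hsteady.not_lt, (hnext.of_rank_eq_zero hrank).2]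

theorem potential_succ_eq_zero (h : potential P rank d t = 0)
    (hsel : selection P d (t + 1) = target P next d t) : potential P rank d (t + 1) = 0 := by
  rw [target_eq_of_potential_eq_zero hP hnext h] at hsel
  rw [potential_eq_zero_iff hP] at h ⊢
  rw [steadiness, if_pos hsel, hsel, h.2]
  exact ⟨h.1, min_eq_left (Nat.le_succ _)⟩

theorem potential_succ_lt (h : potential P rank d t ≠ 0)
    (hsel : selection P d (t + 1) = target P next d t) :
    potential P rank d (t + 1) < potential P rank d t := by
  have hL := hP.L_pos
  by_cases hlt : steadiness P d t < P.L
  · rw [target, if_pos hlt] at hsel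
    rw [potential, potential, steadiness, if_pos hsel, hsel]
    omega
  · have hsteady : steadiness P d t = P.L := (steadiness_le hP t).antisymm (not_lt.1 hlt)
    have hdrop := (hnext.of_rank_ne_zero fun h0 => h ((potential_eq_zero_iff hP).2
      ⟨h0, hsteady⟩)).2
    rw [target, if_neg hlt] at hsel
    have hne : selection P d (t + 1) ≠ selection P d t := fun heq => by
      rw [← hsel, heq] at hdrop
      exact lt_irrefl _ hdrop
    rw [potential, potential, steadiness, if_neg hne, hsel, hsteady]
    have hmul := Nat.mul_le_mul_left P.L (Nat.succ_le_of_lt hdrop)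
    rw [Nat.mul_succ] at hmul
    omega

variable (hG : G.Standing) (ht : 2 ≤ t) (hs : Accurate G (stateAt G P d g t))
include hG ht hs

theorem target_eq_or_mem_betterReplies (m : Fin M) :
    target P next d t m = selection P d t m ∨
      target P next d t m ∈ betterReplies G P d g (t + 1) m := by
  by_cases hpot : potential P rank d t = 0
  · exact Or.inl (congrFun (target_eq_of_potential_eq_zero hP hnext hpot) m)
  by_cases hlt : steadiness P d t < P.L
  · exact Or.inl (congrFun (if_pos hlt) m)
  have hsteady : steadiness P d t = P.L := (steadiness_le hP t).antisymm (not_lt.1 hlt)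
  obtain ⟨i, x, hx, hmem⟩ := exists_mem_betterReplies_of_step hP ht hsteady hG hs
    (hnext.of_rank_ne_zero fun h0 => hpot ((potential_eq_zero_iff hP).2 ⟨h0, hsteady⟩)).1
  rw [target, if_neg hlt, hx]
  rcases eq_or_ne m i with rfl | hmi
  · exact Or.inr (by rwa [Function.update_self])
  · exact Or.inl (Function.update_of_ne hmi _ _)

theorem exploitProb_target_eq_one (hties : G.NoTies) (h : potential P rank d t = 0) (m : Fin M) :
    exploitProb G P d g (t + 1) m (target P next d t m, false) = 1 := by
  rw [target_eq_of_potential_eq_zero hP hnext h]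
  exact exploitProb_eq_one m (betterReplies_eq_empty hP ht ((potential_eq_zero_iff hP).1 h).2 hG hs
    hties (isEquilibrium_of_potential_eq_zero hP hnext h) m)

end Approach

/-! ### Runs of the algorithm -/

namespace IsRun

variable {M N : ℕ} {G : Network M N} {P : Params M N} {Ω : Type*} {mΩ : MeasurableSpace Ω}
  {μ : Measure Ω} {ℱ : Filtration ℕ mΩ} {D : ℕ → Ω → Fin M → Decision N}
  {g : ℕ → Ω → Gains M N} {t : ℕ}

section Adapted

variable (hrun : IsRun G P μ ℱ D g)
include hrun

theorem measurableSet_decision (ht : 2 ≤ t) (y : Fin M → Decision N) :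
    MeasurableSet[ℱ t] {ω | D t ω = y} :=
  hrun.decision_adapted t ht (show MeasurableSet[⊤] {y} from trivial)

theorem measurable_stateAt : ∀ t, Measurable[ℱ t] fun ω => stateAt G P (D · ω) (g · ω) t
  | 0 => measurable_const
  | 1 => measurable_const
  | t + 2 => measurable_apply_of_countable (hrun.decision_adapted (t + 2) (by omega))
      (F := fun y ω => step G (stateAt G P (D · ω) (g · ω) (t + 1)) y (g (t + 2) ω)) fun y =>
        (measurable_step y).comp
          (((measurable_stateAt (t + 1)).mono (ℱ.mono (Nat.le_succ _)) le_rfl).prodMk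
            (hrun.gains_adapted (t + 2) (by omega)))

theorem measurable_selection (t : ℕ) :
    Measurable[ℱ t, ⊤] fun ω => selection P (D · ω) t := by
  by_cases ht : t ≤ 1
  · simp only [selection, if_pos ht]
    exact @measurable_const _ _ ⊤ (ℱ t) P.b1
  · simp only [selection, if_neg ht]
    exact (@measurable_from_top _ _ ⊤ fun y m => (y m).1).comp
      (hrun.decision_adapted t (by omega))

theorem measurable_steadiness : ∀ t, Measurable[ℱ t] fun ω => steadiness P (D · ω) t
  | 0 => measurable_const
  | t + 1 => by
    let : MeasurableSpace (Profile M N) := ⊤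
    have hle := ℱ.mono (Nat.le_succ t)
    have hsel := (hrun.measurable_selection t).mono hle le_rfl
    have hsteady := (measurable_steadiness t).mono hle le_rfl
    simp only [steadiness]
    exact Measurable.ite (measurableSet_eq_fun (hrun.measurable_selection (t + 1)) hsel)
      (measurable_const.min (hsteady.add measurable_const)) measurable_const

theorem measurable_target (next : Profile M N → Profile M N) (t : ℕ) :
    Measurable[ℱ t, ⊤] fun ω => target P next (D · ω) t := by
  let : MeasurableSpace (Profile M N) := ⊤
  have hsel := hrun.measurable_selection t
  exact Measurable.ite (measurableSet_lt (hrun.measurable_steadiness t) measurable_const) hsel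
    (measurable_from_top.comp hsel)

theorem measurable_potential (rank : Profile M N → ℕ) (t : ℕ) :
    Measurable[ℱ t] fun ω => potential P rank (D · ω) t :=
  (measurable_const.mul (measurable_from_top.comp (hrun.measurable_selection t))).add
    (measurable_const.sub (hrun.measurable_steadiness t))

theorem measurableSet_accurate (t : ℕ) :
    MeasurableSet[ℱ t] {ω | Accurate G (stateAt G P (D · ω) (g · ω) t)} :=
  hrun.measurable_stateAt t EBRIQ.measurableSet_accurate

end Adapted

section Decisions

variable [IsProbabilityMeasure μ] (hrun : IsRun G P μ ℱ D g)
include hrun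

theorem mul_measureReal_le_of_const (ht : 1 ≤ t) {E : Set Ω} (hE : MeasurableSet[ℱ t] E)
    (y : Fin M → Decision N) {p : ℝ}
    (hp : ∀ ω ∈ E, p ≤ ∏ m, decisionProb G P (D · ω) (g · ω) (t + 1) m (y m)) :
    p * μ.real E ≤ μ.real (E ∩ {ω | D (t + 1) ω = y}) := by
  have hy : MeasurableSet {ω | D (t + 1) ω = y} :=
    ℱ.le _ _ (hrun.measurableSet_decision (by omega) y)
  calc p * μ.real E = ∫ _ in E, p ∂μ := by simp [mul_comm]
    _ ≤ ∫ ω in E, (μ[{ω | D (t + 1) ω = y}.indicator fun _ => (1 : ℝ) | ℱ t]) ω ∂μ := by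
      refine setIntegral_mono_on_ae (integrable_const p).integrableOn
        integrable_condExp.integrableOn (ℱ.le t _ hE) ?_
      filter_upwards [hrun.decision_law (t + 1) (by omega) y] with ω hω hωE
      exact (hp ω hωE).trans_eq hω.symm
    _ = μ.real (E ∩ {ω | D (t + 1) ω = y}) := by
      rw [setIntegral_condExp (ℱ.le t) ((integrable_const 1).indicator hy) hE,
        setIntegral_indicator hy]
      simp

theorem mul_measureReal_le (ht : 1 ≤ t) {E : Set Ω} (hE : MeasurableSet[ℱ t] E)
    {Y : Ω → Fin M → Decision N} (hY : Measurable[ℱ t, ⊤] Y) {p : ℝ}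
    (hp : ∀ ω ∈ E, p ≤ ∏ m, decisionProb G P (D · ω) (g · ω) (t + 1) m (Y ω m)) :
    p * μ.real E ≤ μ.real (E ∩ {ω | D (t + 1) ω = Y ω}) := by
  have hYm (y : Fin M → Decision N) : MeasurableSet[ℱ t] (Y ⁻¹' {y}) := hY trivial
  have hsum (S : Set Ω) : ∑ y, μ.real (S ∩ Y ⁻¹' {y}) = μ.real S := by
    simpa [measureReal_restrict_apply, ℱ.le t _ (hYm _), Set.inter_comm] using
      sum_measureReal_preimage_singleton (μ := μ.restrict S) (f := Y) Finset.univ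
        fun y _ => ℱ.le t _ (hYm y)
  rw [← hsum E, ← hsum (E ∩ _), Finset.mul_sum]
  refine Finset.sum_le_sum fun y _ => (hrun.mul_measureReal_le_of_const ht (hE.inter (hYm y)) y
    fun ω hω => ?_).trans_eq (congrArg μ.real ?_)
  · rw [← show Y ω = y from hω.2]
    exact hp ω hω.1
  · ext ω
    simp only [Set.mem_inter_iff, Set.mem_preimage, Set.mem_singleton_iff, Set.mem_ofPred_eq]
    exact ⟨fun ⟨⟨hE, hy⟩, hD⟩ => ⟨⟨hE, hD.trans hy.symm⟩, hy⟩,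
      fun ⟨⟨hE, hD⟩, hy⟩ => ⟨⟨hE, hy⟩, hD.trans hy⟩⟩

theorem ae_frequently_eq (hP : P.Valid) {y : Fin M → Decision N} (hy : ∀ m, (y m).1 ≠ none) :
    ∀ᵐ ω ∂μ, ∃ᶠ t in atTop, D t ω = y := by
  let 𝒢 : Filtration ℕ mΩ :=
    ⟨fun t => ℱ (t + 2), fun _ _ h => ℱ.mono (by omega), fun t => ℱ.le _⟩
  have hs : ∀ t, MeasurableSet[𝒢 t] {ω | D (t + 2) ω = y} :=
    fun t => hrun.measurableSet_decision (by omega) y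
  have hq : 0 < ∏ m, exploreProb P (y m) := Finset.prod_pos fun m _ => exploreProb_pos hP (hy m)
  have hc : 0 < P.ε₀ ^ M / 3 * ∏ m, exploreProb P (y m) :=
    mul_pos (div_pos (pow_pos hP.ε₀_pos _) three_pos) hq
  have hlaw : ∀ᵐ ω ∂μ, ∀ k : ℕ, P.ε₀ ^ M / 3 * (∏ m, exploreProb P (y m)) / (k + 1) ≤
      (μ[({ω | D (k + 1 + 2) ω = y}).indicator (1 : Ω → ℝ) | 𝒢 k]) ω := by
    refine ae_all_iff.2 fun k => ?_
    filter_upwards [hrun.decision_law (k + 1 + 2) (by omega) y] with ω hω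
    refine le_trans ?_ ((explore_le_prod_decisionProb hP (by omega) y).trans_eq hω.symm)
    rw [mul_div_right_comm, div_div]
    refine mul_le_mul_of_nonneg_right (le_trans ?_ (hP.div_le_ε_pow (by omega))) hq.le
    refine div_le_div_of_nonneg_left (pow_nonneg hP.ε₀_pos.le _) (by positivity) ?_
    push_cast
    linarith [Nat.cast_nonneg (α := ℝ) k]
  filter_upwards [ae_mem_limsup_atTop_iff μ hs, hlaw] with ω hlimsup hω
  have hfreq := mem_limsup_iff_frequently_mem.1
    (hlimsup.2 (tendsto_sum_atTop_of_div_le hc hω))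
  exact (tendsto_add_atTop_nat 2).frequently hfreq

end Decisions

section Estimates

variable (hrun : IsRun G P μ ℱ D g)

include hrun in
theorem identDistrib_relayRate (m : Fin M) (n : Fin N) (t : ℕ) :
    IdentDistrib (fun ω => G.relayRate (g (t + 2) ω) m n) (fun h => G.relayRate h m n) μ G.law := by
  have hg := (hrun.gains_adapted (t + 2) (by omega)).mono (ℱ.le _) le_rfl
  refine IdentDistrib.comp (f := g (t + 2)) (g := id) ?_ (measurable_relayRate m n)
  exact ⟨hg.aemeasurable, aemeasurable_id, by rw [hrun.gains_law _ (by omega), Measure.map_id]⟩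

include hrun in
theorem indep_relayRate (m : Fin M) (n : Fin N) (t : ℕ) :
    Indep (MeasurableSpace.comap (fun ω => G.relayRate (g (t + 2) ω) m n) inferInstance)
      (ℱ (t + 1) ⊔ MeasurableSpace.comap (D (t + 2)) ⊤) μ := by
  refine indep_of_indep_of_le_left (hrun.gains_indep (t + 2) (by omega)) ?_
  rintro _ ⟨B, hB, rfl⟩
  exact ⟨_, measurable_relayRate m n hB, rfl⟩

/-- What is known in period `t + 2` when the pairs select: the past and the decisions of the
period, but not its gains. -/
def selectionFiltration : Filtration ℕ mΩ where
  seq t := ℱ (t + 1) ⊔ MeasurableSpace.comap (D (t + 2)) ⊤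
  mono' := monotone_nat_of_le_succ fun t => (sup_le (ℱ.mono (Nat.le_succ _))
    (hrun.decision_adapted (t + 2) (by omega)).comap_le).trans le_sup_left
  le' t := sup_le (ℱ.le _)
    ((hrun.decision_adapted (t + 2) (by omega)).comap_le.trans (ℱ.le _))

theorem measurableSet_selected (m : Fin M) (n : Fin N) (t : ℕ) :
    MeasurableSet[hrun.selectionFiltration t]
      {ω | Selected G (stateAt G P (D · ω) (g · ω) (t + 1)) (D (t + 2) ω) m n} := by
  have hD : Measurable[hrun.selectionFiltration t, ⊤] (D (t + 2)) :=
    (@comap_measurable _ _ ⊤ (D (t + 2))).mono le_sup_right le_rfl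
  exact @Measurable.setOf _ (hrun.selectionFiltration t) _ (measurable_apply_of_countable hD
    (F := fun y ω => Selected G (stateAt G P (D · ω) (g · ω) (t + 1)) y m n) fun y =>
      (measurable_selected y m n).comp ((hrun.measurable_stateAt (t + 1)).mono le_sup_left le_rfl))

variable [IsProbabilityMeasure μ] (hG : G.Standing) (hP : P.Valid)
include hrun hG hP

theorem ae_infinite_selected (m : Fin M) (n : Fin N) : ∀ᵐ ω ∂μ,
    {t | Selected G (stateAt G P (D · ω) (g · ω) (t + 1)) (D (t + 2) ω) m n}.Infinite := by
  filter_upwards [hrun.ae_frequently_eq hP (y := boldDecision m n)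
    fun _ => by simp [boldDecision]] with ω hω
  rw [← Nat.frequently_atTop_iff_infinite]
  rw [← map_add_atTop_eq_nat 2, frequently_map] at hω
  refine hω.mono fun t ht => ?_
  rw [ht]
  exact selected_boldDecision hG _ m n

theorem ae_tendsto_Rhat : ∀ᵐ ω ∂μ, ∀ m n,
    Tendsto (fun t => (stateAt G P (D · ω) (g · ω) t).Rhat m n) atTop (𝓝 (G.RC m n)) := by
  refine ae_all_iff.2 fun m => ae_all_iff.2 fun n => ?_
  have hid := hrun.identDistrib_relayRate m n
  have hinf := hrun.ae_infinite_selected hG hP m n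
  have hlaw := strong_law_optional_skipping (H := hrun.selectionFiltration)
    (r := fun t ω => G.relayRate (g (t + 2) ω) m n) (hrun.measurableSet_selected m n)
    (fun t => (measurable_relayRate m n).comp
      ((hrun.gains_adapted (t + 2) (by omega)).mono le_sup_left le_rfl))
    (fun t => (hid t).trans (hid 0).symm) (hrun.indep_relayRate m n) hinf
    ((hid 0).integrable_iff.2 (hG.relay_integrable m n))
  filter_upwards [hinf, hlaw] with ω hω hlim
  classical
  rw [(hid 0).integral_eq] at hlim
  refine tendsto_Rhat hω (hlim.congr fun t => ?_)
  simp only [smul_eq_mul, Set.indicator_apply, Set.mem_ofPred_eq]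

theorem ae_eventually_accurate (hties : G.NoTies) :
    ∀ᵐ ω ∂μ, ∀ᶠ t in atTop, Accurate G (stateAt G P (D · ω) (g · ω) t) := by
  have hfreq : ∀ᵐ ω ∂μ, ∀ n : Fin N, ∃ᶠ t in atTop, D t ω = fun _ => (some n, false) :=
    ae_all_iff.2 fun n => hrun.ae_frequently_eq hP fun _ => by simp
  filter_upwards [hrun.ae_tendsto_Rhat hG hP, hfreq] with ω hR hω
  exact eventually_accurate hG hR hties hω

end Estimates

section Settling

variable [IsProbabilityMeasure μ] (hrun : IsRun G P μ ℱ D g) (hP : P.Valid)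
  {rank : Profile M N → ℕ} {next : Profile M N → Profile M N}
include hrun hP

theorem mul_measureReal_le_selection_eq_target (ht : 1 ≤ t) {E : Set Ω}
    (hE : MeasurableSet[ℱ t] E) {p : ℝ} (hp : 0 ≤ p)
    (hpE : ∀ ω ∈ E, ∀ m,
      p ≤ exploitProb G P (D · ω) (g · ω) (t + 1) m (target P next (D · ω) t m, false)) :
    (1 - P.ε (t + 1)) ^ M * p ^ M * μ.real E ≤
      μ.real (E ∩ {ω | selection P (D · ω) (t + 1) = target P next (D · ω) t}) := by
  have hY : Measurable[ℱ t, ⊤] fun ω m => (target P next (D · ω) t m, false) :=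
    (@measurable_from_top _ _ ⊤ fun (b : Profile M N) m => (b m, false)).comp
      (hrun.measurable_target next t)
  refine (hrun.mul_measureReal_le ht hE hY fun ω hω =>
    exploit_le_prod_decisionProb hP (by omega) hp (hpE ω hω)).trans (measureReal_mono ?_)
  exact Set.inter_subset_inter_right _ fun ω hω => selection_succ_of_eq ht hω

variable (hG : G.Standing) (hties : G.NoTies)
include hG hties

theorem tendsto_potential_ne_zero (hnext : LeadsToEquilibrium G rank next) :
    Tendsto (fun t => μ.real {ω | potential P rank (D · ω) t ≠ 0}) atTop (𝓝 0) := by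
  obtain ⟨p, hp, hp1, hexploit⟩ := exists_pos_le_exploitProb hP G
  have hε := hP.tendsto_one_sub_ε_pow.comp (tendsto_add_atTop_nat 1)
  have hq1 : 1 / 2 * p ^ M ≤ 1 :=
    mul_le_one₀ (by norm_num) (by positivity) (pow_le_one₀ hp.le hp1)
  refine tendsto_measureReal_ne_zero_of_drift (q := 1 / 2 * p ^ M) (by positivity) hq1 hε
    (hrun.measurable_potential rank) (fun t ω => potential_le) hrun.measurableSet_accurate
    (hrun.ae_eventually_accurate hG hP hties) ?_ ?_
  · filter_upwards [hε.eventually_const_le one_half_lt_one, eventually_ge_atTop 2]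
      with t hεt ht E hEA hE hpot
    refine (mul_le_mul_of_nonneg_right (mul_le_mul_of_nonneg_right hεt (pow_nonneg hp.le M))
      measureReal_nonneg).trans ((hrun.mul_measureReal_le_selection_eq_target hP (next := next)
        (by omega) hE hp.le fun ω hω m => ?_).trans (measureReal_mono ?_))
    · exact hexploit _ _ _ _ _ (target_eq_or_mem_betterReplies hP hnext hG ht (hEA hω) m)
    · rintro ω ⟨hωE, hω⟩
      exact ⟨hωE, potential_succ_lt hP hnext (hpot ω hωE) hω⟩
  · filter_upwards [eventually_ge_atTop 2] with t ht E hEA hE hpot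
    refine (le_of_eq ?_).trans ((hrun.mul_measureReal_le_selection_eq_target hP (next := next)
      (by omega) hE zero_le_one fun ω hω m => ?_).trans (measureReal_mono ?_))
    · rw [one_pow, mul_one, Function.comp_apply]
    · exact (exploitProb_target_eq_one hP hnext hG ht (hEA hω) hties (hpot ω hω) m).ge
    · rintro ω ⟨hωE, hω⟩
      exact ⟨hωE, potential_succ_eq_zero hP hnext (hpot ω hωE) hω⟩

theorem tendsto_isStable :
    Tendsto (fun t => μ {ω | G.IsStable (G.matching (selection P (D · ω) t))}) atTop (𝓝 1) := by
  obtain ⟨rank, next, hnext⟩ := exists_leadsToEquilibrium G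
  have hzero (t : ℕ) : 1 - μ.real {ω | potential P rank (D · ω) t ≠ 0} =
      μ.real {ω | potential P rank (D · ω) t = 0} := by
    rw [← probReal_compl_eq_one_sub]
    · simp [Set.compl_def]
    · exact ℱ.le t _ (hrun.measurable_potential rank t (measurableSet_singleton 0).compl)
  have hlim : Tendsto (fun t => μ {ω | potential P rank (D · ω) t = 0}) atTop (𝓝 1) := by
    have h := (hrun.tendsto_potential_ne_zero hP hG hties hnext).const_sub 1
    simp only [hzero, sub_zero] at h
    simpa using ENNReal.tendsto_ofReal h
  refine tendsto_of_tendsto_of_tendsto_of_le_of_le hlim tendsto_const_nhds (fun t => ?_)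
    fun t => prob_le_one
  exact measure_mono fun ω hω =>
    Network.isStable_of_isEquilibrium (isEquilibrium_of_potential_eq_zero hP hnext hω) hG

end Settling

end IsRun

end EBRIQ

end

theorem theorem3 {M N : ℕ} (hN : 0 < N)
    (G : EBRIQ.Network M N) (hG : G.Standing) (hties : G.NoTies)
    (P : EBRIQ.Params M N) (hP : P.Valid)
    {Ω : Type*} {mΩ : MeasurableSpace Ω} (μ : Measure Ω) [IsProbabilityMeasure μ]
    (ℱ : Filtration ℕ mΩ)
    (D : ℕ → Ω → Fin M → EBRIQ.Decision N) (g : ℕ → Ω → EBRIQ.Gains M N)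
    (hrun : EBRIQ.IsRun G P μ ℱ D g) :
    (∀ᵐ ω ∂μ, ∀ (m : Fin M) (n : Fin N),
      Tendsto (fun t => EBRIQ.alphaAt G P (fun τ => D τ ω) (fun τ => g τ ω) t m n) atTop
        (𝓝 (G.alphaStar m n))) ∧
    Tendsto
      (fun t => μ {ω | G.IsStable (G.matching (EBRIQ.selection P (fun τ => D τ ω) t))}) atTop
      (𝓝 1) := by
  refine ⟨?_, hrun.tendsto_isStable hP hG hties⟩
  filter_upwards [hrun.ae_tendsto_Rhat hG hP] with ω hω
  exact EBRIQ.tendsto_alphaAt hG hω
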